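/- Let $A=(a_{ij})$ be an $n\times n$ matrix with entries in $\{0,1\}$ and let $\underline T=(T_1,\dots,T_n)$ be a tuple of bounded operators on a (separable) complex Hilbert space $\mathcal H$ with $\sum_i T_iT_i^*\le I$ and $T_iT_j=a_{ij}T_iT_j$ for all $i,j$. For a word $\alpha=\alpha_1\cdots\alpha_m$ in the letters $1,\dots,n$ write $|\alpha|=m$ and $\underline T^\alpha=T_{\alpha_1}\cdots T_{\alpha_m}$, with $\underline T^\alpha=I$ for the empty word. A minimal dilation of $\underline T$ is a tuple $\underline R$ on a Hilbert space $\mathcal L\supseteq\mathcal H$ such that $R_i^*h=T_i^*h$ for all $h\in\mathcal H$ and all $i$, and such that the vectors $\underline R^\alpha h$ ($\alpha$ a word, $h\in\mathcal H$) span a dense subspace of $\mathcal L$. Let $\hat{\underline T}$ on $\hat{\mathcal H}$ be the minimal isometric dilation of $\underline T$, that is, a minimal dilation consisting of isometries with mutually orthogonal ranges. Let $\tilde{\underline T}$ on $\tilde{\mathcal H}$ be the minimal Cuntz–Krieger dilation of $\underline T$, that is, a minimal dilation consisting of partial isometries with mutually orthogonal ranges such that $\tilde T_i\tilde T_j=a_{ij}\tilde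 T_i\tilde T_j$ and $\tilde T_i^*\tilde T_i=I-\sum_j(1-a_{ij})\tilde T_j\tilde T_j^*$ for all $i,j$. Let $L_1,\dots,L_n$ be the left creation operators on the full Fock space $\Gamma(\mathbb C^n)$, let the $A$-Fock space $\Gamma_A$ be the orthogonal complement in $\Gamma(\mathbb C^n)$ of all vectors $\underline L^\alpha(L_iL_j-a_{ij}L_iL_j)x$, let $S_i$ be the compression of $L_i$ to $\Gamma_A$, and let $C^*(\underline S)$ be the unital C*-algebra generated by $S_1,\dots,S_n$. Then: 1. $\operatorname{rank}(I-\sum_i\hat T_i\hat T_i^*)=\operatorname{rank}(I-\sum_i\tilde T_i\tilde T_i^*)=\operatorname{rank}(I-\sum_i T_iT_i^*)$ in $\mathbb N\cup\{\infty\}$. 2. There is a unique unital $*$-homomorphism $\pi_1:C^*(\underline S)\to B(\tilde{\mathcal H})$ with $\pi_1(S_i)=\tilde T_i$ for all $i$. With $\tilde{\mathcal H}_C=\overline{\operatorname{span}}\{\pi_1(X)h: h\in\tilde{\mathcal H},\ X\in C^*(\underline S)\text{ compact}\}$ and $\tilde{\mathcal H}_N=\tilde{\mathcal H}\ominus\tilde{\mathcal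 H}_C$ one has $$\lim_{k\to\infty}\sum_{|\alpha|=k}\tilde{\underline T}^\alpha(\tilde{\underline T}^\alpha)^*=P_{\tilde{\mathcal H}_N}$$ in the strong operator topology, where $P_{\tilde{\mathcal H}_N}$ is the orthogonal projection of $\tilde{\mathcal H}$ onto $\tilde{\mathcal H}_N$. -/

import Mathlib

open Filter Topology

noncomputable section

namespace CuntzKriegerDilation

universe u v

section Tuples

variable {n : ℕ} {H : Type u} [NormedAddCommGroup H] [InnerProductSpace ℂ H]
variable {L : Type v} [NormedAddCommGroup L] [InnerProductSpace ℂ L]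

/-- `A` is a matrix all of whose entries are `0` or `1`. -/
def IsZeroOne (A : Matrix (Fin n) (Fin n) ℂ) : Prop :=
  ∀ i j, A i j = 0 ∨ A i j = 1

/-- The operator `T^α = T_{α₁} T_{α₂} ⋯ T_{αₘ}` of a word `α = α₁ α₂ ⋯ αₘ`; it is the identity for
the empty word. -/
def wordOp (T : Fin n → H →L[ℂ] H) (α : List (Fin n)) : H →L[ℂ] H :=
  (α.map T).prod

/-- The `A`-relations `T_i T_j = a_{ij} T_i T_j`. -/
def SatisfiesARelations (A : Matrix (Fin n) (Fin n) ℂ) (T : Fin n → H →L[ℂ] H) : Prop :=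
  ∀ i j, T i * T j = A i j • (T i * T j)

/-- The operators of the tuple have mutually orthogonal ranges. -/
def HasOrthogonalRanges (T : Fin n → H →L[ℂ] H) : Prop :=
  ∀ i j, i ≠ j → ∀ x y, inner ℂ (T i x) (T j y) = 0

/-- The maximal `A`-relation subspace of a tuple `R`: the orthogonal complement of all vectors
`R^α (R_i R_j - a_{ij} R_i R_j) h`. -/
abbrev maximalARelationSubspace (A : Matrix (Fin n) (Fin n) ℂ) (R : Fin n → L →L[ℂ] L) :
    Submodule ℂ L :=
  (Submodule.span ℂ {x : L | ∃ (α : List (Fin n)) (i j : Fin n) (h : L),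
    x = wordOp R α ((R i * R j - A i j • (R i * R j)) h)})ᗮ

/-- The rank of an operator, that is the dimension of its range, as an element of `ℕ ∪ {∞}`. -/
def opRank (T : H →L[ℂ] H) : ℕ∞ :=
  Cardinal.toENat (LinearMap.rank (T : H →ₗ[ℂ] H))

/-- The tuple `R` on `L` is a dilation of the tuple `T` on `H`, where `H` is regarded as a subspace
of `L` through the isometric embedding `V`: `R_i^* h = T_i^* h` for `h ∈ H`. -/
def IsDilation [CompleteSpace H] [CompleteSpace L] (T : Fin n → H →L[ℂ] H) (V : H →ₗᵢ[ℂ] L)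
    (R : Fin n → L →L[ℂ] L) : Prop :=
  ∀ i h, (star (R i)) (V h) = V ((star (T i)) h)

/-- Minimality of a dilation: the vectors `R^α h` with `h ∈ H` span a dense subspace of `L`. -/
def IsMinimal (V : H →ₗᵢ[ℂ] L) (R : Fin n → L →L[ℂ] L) : Prop :=
  (Submodule.span ℂ {x : L | ∃ (α : List (Fin n)) (h : H),
    x = wordOp R α (V h)}).topologicalClosure = ⊤

variable [CompleteSpace H] [CompleteSpace L]

/-- `I - ∑ T_i T_i^*`, the square of the defect operator of `T`. -/
def defect (T : Fin n → H →L[ℂ] H) : H →L[ℂ] H :=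
  1 - ∑ i, T i * star (T i)

/-- `T` is a contractive tuple, `∑ T_i T_i^* ≤ I`, in the order of self-adjoint operators. -/
def IsContractive (T : Fin n → H →L[ℂ] H) : Prop :=
  ∑ i, T i * star (T i) ≤ 1

/-- `R` is a minimal isometric dilation of `T`. -/
structure IsMinimalIsometricDilation (T : Fin n → H →L[ℂ] H) (V : H →ₗᵢ[ℂ] L)
    (R : Fin n → L →L[ℂ] L) : Prop where
  dilation : IsDilation T V R
  minimal : IsMinimal V R
  isometry : ∀ i, Isometry (R i)
  orthogonal : HasOrthogonalRanges R

/-- `R` is a minimal Cuntz–Krieger dilation of `T`: a minimal dilation by partial isometries with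
orthogonal ranges which satisfies the `A`-relations and
`R_i^* R_i = I - ∑_j (1 - a_{ij}) R_j R_j^*`. -/
structure IsMinimalCuntzKriegerDilation (A : Matrix (Fin n) (Fin n) ℂ) (T : Fin n → H →L[ℂ] H)
    (V : H →ₗᵢ[ℂ] L) (R : Fin n → L →L[ℂ] L) : Prop where
  dilation : IsDilation T V R
  minimal : IsMinimal V R
  partialIsometry : ∀ i, R i * star (R i) * R i = R i
  orthogonal : HasOrthogonalRanges R
  aRelations : SatisfiesARelations A R
  cuntzKrieger : ∀ i, star (R i) * R i = 1 - ∑ j, (1 - A i j) • (R j * star (R j))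

end Tuples

section Fock

/-- The full Fock space over `ℂⁿ`, written in its orthonormal basis `e^α` of elementary tensors,
which is indexed by the words `α` in `n` letters; the empty word gives the vacuum vector. -/
abbrev Fock (n : ℕ) : Type :=
  lp (fun _ : List (Fin n) => ℂ) 2

variable {n : ℕ}

theorem hasSum_cons_extend (i : Fin n) (f : Fock n) :
    HasSum (fun w => ‖Function.extend (List.cons i) (⇑f) 0 w‖ ^ (2 : ENNReal).toReal)
      (‖f‖ ^ (2 : ENNReal).toReal) := by
  have h : (fun w => ‖Function.extend (List.cons i) (⇑f) 0 w‖ ^ (2 : ENNReal).toReal)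
      = Function.extend (List.cons i) (fun w => ‖f w‖ ^ (2 : ENNReal).toReal) 0 := by
    funext w
    by_cases hw : ∃ a, i :: a = w
    · obtain ⟨a, rfl⟩ := hw
      rw [List.cons_injective.extend_apply, List.cons_injective.extend_apply]
    · rw [Function.extend_apply' _ _ _ hw, Function.extend_apply' _ _ _ hw]
      simp
  rw [h, hasSum_extend_zero List.cons_injective]
  exact lp.hasSum_norm (by norm_num) f

/-- The left creation operator `L_i x = e_i ⊗ x` on the full Fock space: the coefficient of
`L_i f` at a word `i w` is that of `f` at `w`, and all its other coefficients vanish. -/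
def creation (i : Fin n) : Fock n →L[ℂ] Fock n :=
  LinearIsometry.toContinuousLinearMap
    { toFun := fun f => ⟨Function.extend (List.cons i) (⇑f) 0,
        memℓp_gen (hasSum_cons_extend i f).summable⟩
      map_add' := by
        intro f g
        apply lp.ext
        funext w
        change Function.extend (List.cons i) (⇑f + ⇑g) 0 w
          = Function.extend (List.cons i) (⇑f) 0 w + Function.extend (List.cons i) (⇑g) 0 w
        by_cases hw : ∃ a, i :: a = w
        · obtain ⟨a, rfl⟩ := hw
          simp only [List.cons_injective.extend_apply, Pi.add_apply]
        · simp only [Function.extend_apply' _ _ _ hw, Pi.zero_apply, add_zero]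
      map_smul' := by
        intro c f
        apply lp.ext
        funext w
        change Function.extend (List.cons i) (c • ⇑f) 0 w
          = c • Function.extend (List.cons i) (⇑f) 0 w
        by_cases hw : ∃ a, i :: a = w
        · obtain ⟨a, rfl⟩ := hw
          simp only [List.cons_injective.extend_apply, Pi.smul_apply]
        · simp only [Function.extend_apply' _ _ _ hw, Pi.zero_apply, smul_zero]
      norm_map' := by
        intro f
        have h2 : 0 < (2 : ENNReal).toReal := by norm_num
        refine (Real.rpow_left_inj (norm_nonneg _) (norm_nonneg _) h2.ne').1 ?_
        exact (lp.hasSum_norm h2 _).unique (hasSum_cons_extend i f) }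

/-- The `A`-Fock space `Γ_A`: the maximal `A`-relation subspace of the creation operators, with the
Hilbert space structure of a closed subspace of the full Fock space. -/
def AFock (A : Matrix (Fin n) (Fin n) ℂ) : Type :=
  maximalARelationSubspace A (creation (n := n))

instance (A : Matrix (Fin n) (Fin n) ℂ) : NormedAddCommGroup (AFock A) :=
  inferInstanceAs (NormedAddCommGroup (maximalARelationSubspace A (creation (n := n))))

instance (A : Matrix (Fin n) (Fin n) ℂ) : InnerProductSpace ℂ (AFock A) :=
  inferInstanceAs (InnerProductSpace ℂ (maximalARelationSubspace A (creation (n := n))))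

instance (A : Matrix (Fin n) (Fin n) ℂ) : CompleteSpace (AFock A) :=
  inferInstanceAs (CompleteSpace (maximalARelationSubspace A (creation (n := n))))

/-- The inclusion of `Γ_A` into the full Fock space. Its adjoint is the orthogonal projection of
the full Fock space onto `Γ_A`. -/
def AFock.incl (A : Matrix (Fin n) (Fin n) ℂ) : AFock A →ₗᵢ[ℂ] Fock n :=
  (maximalARelationSubspace A (creation (n := n))).subtypeₗᵢ

/-- `S_i`, the compression of the creation operator `L_i` to the `A`-Fock space. -/
def aCreation (A : Matrix (Fin n) (Fin n) ℂ) (i : Fin n) : AFock A →L[ℂ] AFock A :=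
  ContinuousLinearMap.adjoint (AFock.incl A).toContinuousLinearMap ∘L
    creation i ∘L (AFock.incl A).toContinuousLinearMap

/-- `C^*(S)`, the (unital) C*-algebra of operators on the `A`-Fock space generated by
`S_1, …, S_n`. -/
abbrev cStarS (A : Matrix (Fin n) (Fin n) ℂ) : StarSubalgebra ℂ (AFock A →L[ℂ] AFock A) :=
  (StarAlgebra.adjoin ℂ (Set.range (aCreation A))).topologicalClosure

/-- `S_i` as an element of `C^*(S)`. -/
def gen (A : Matrix (Fin n) (Fin n) ℂ) (i : Fin n) : cStarS A :=
  ⟨aCreation A i, StarSubalgebra.le_topologicalClosure _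
    (StarAlgebra.subset_adjoin ℂ _ (Set.mem_range_self i))⟩

variable {A : Matrix (Fin n) (Fin n) ℂ} {L : Type u} [NormedAddCommGroup L]
  [InnerProductSpace ℂ L] [CompleteSpace L]

/-- For a representation `π` of `C^*(S)` on `L`, the closed span `L_C` of all vectors `π(X) h` with
`X ∈ C^*(S)` compact and `h ∈ L`. -/
def compactPart (π : cStarS A →⋆ₐ[ℂ] (L →L[ℂ] L)) : Submodule ℂ L :=
  (Submodule.span ℂ {x : L | ∃ (X : cStarS A) (h : L),
    IsCompactOperator (X : AFock A →L[ℂ] AFock A) ∧ x = π X h}).topologicalClosure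

/-- The complementary summand `L_N` in `L = L_C ⊕ L_N`, on which the compacts act trivially. -/
abbrev noncompactPart (π : cStarS A →⋆ₐ[ℂ] (L →L[ℂ] L)) : Submodule ℂ L :=
  (compactPart π)ᗮ

end Fock

end CuntzKriegerDilation

end

/-! Ranks. For a minimal dilation `R` by partial isometries with orthogonal ranges, `Q = defect R`
is a projection that kills every range of `R i`. By minimality `Q V H` is therefore dense in the
range of `Q`, while `R_i^* V = V T_i^*` gives `⟨Q V x, Q V y⟩ = ⟨x, (defect T) y⟩`. So `Q V` and
`defect T` have the same kernel, hence the same rank, and density makes this the rank of `Q` in `ℕ ∪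
{∞}` (`opRank_defect_eq`). The isometric and the Cuntz–Krieger dilations are both covered.

Representation. The core is a von Neumann inequality, `norm_snd_le_norm_fst`: for every contractive
tuple `T` with the `A`-relations, a combination of the `T^α (T^β)^*` has norm at most that of the
same combination of the `S^α (S^β)^*`. If `∑_{|α|=k} T^α (T^α)^* → 0` strongly, the Poisson kernel
`x ↦ ∑_w e^w ⊗ D (T^w)^* x`, with `D^* D = defect T`, is an isometry transporting one combination to
the other; in general one scales `T` by `r < 1` and lets `r → 1`. The inequality is applied to the
Cuntz–Krieger dilation itself. Its relations, shared by `S`, reduce every *-polynomial to such a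
combination, so the closed *-algebra generated by the pairs `(S_i, R_i)` is the graph of the desired
homomorphism.

Limit. On `Γ_A` the operator `1 - ∑_{|α|=k} S^α (S^α)^*` is the finite-rank projection onto words
shorter than `k`. Its image under `π` has range in `L_C`, so the sums for `R` fix `L_N`. On `L_C`
they tend to zero, because the sums for `S` tend to zero in norm after multiplication by a compact
operator. -/

noncomputable section

namespace CuntzKriegerDilation

/-! ### The `A`-Fock space and its creation operators in the basis of admissible words -/

section FockBasis

variable {n : ℕ} {A : Matrix (Fin n) (Fin n) ℂ}

/-- The elementary tensor `e^w`, a vector of the standard orthonormal basis of the Fock space. -/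
def fockBasis (w : List (Fin n)) : Fock n := lp.single 2 w 1

theorem inner_fockBasis_left (w : List (Fin n)) (f : Fock n) :
    inner ℂ (fockBasis w) f = f w := by
  rw [fockBasis, lp.inner_single_left]
  simp

theorem fockBasis_apply (w v : List (Fin n)) :
    fockBasis w v = if v = w then 1 else 0 := by
  rw [fockBasis, lp.single_apply, Pi.single_apply]

theorem creation_apply_cons (i : Fin n) (f : Fock n) (w : List (Fin n)) :
    creation i f (i :: w) = f w :=
  List.cons_injective.extend_apply _ _ _

theorem creation_apply_nil (i : Fin n) (f : Fock n) : creation i f [] = 0 :=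
  Function.extend_apply' _ _ _ (by simp)

theorem creation_apply_cons_of_ne {i j : Fin n} (h : i ≠ j) (f : Fock n) (w : List (Fin n)) :
    creation i f (j :: w) = 0 :=
  Function.extend_apply' _ _ _ (by simp [h])

theorem creation_fockBasis (i : Fin n) (w : List (Fin n)) :
    creation i (fockBasis w) = fockBasis (i :: w) := by
  apply lp.ext
  funext v
  rcases v with _ | ⟨j, v⟩
  · simp [creation_apply_nil, fockBasis_apply]
  · by_cases h : i = j
    · subst h
      simp [creation_apply_cons, fockBasis_apply]
    · rw [creation_apply_cons_of_ne h, fockBasis_apply, if_neg]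
      simp [Ne.symm h]

theorem adjoint_creation_fockBasis_nil (i : Fin n) :
    ContinuousLinearMap.adjoint (creation i) (fockBasis []) = 0 := by
  refine ext_inner_right ℂ fun f => ?_
  rw [ContinuousLinearMap.adjoint_inner_left, inner_fockBasis_left, creation_apply_nil,
    inner_zero_left]

theorem adjoint_creation_fockBasis_cons (i j : Fin n) (w : List (Fin n)) :
    ContinuousLinearMap.adjoint (creation i) (fockBasis (j :: w))
      = if i = j then fockBasis w else 0 := by
  refine ext_inner_right ℂ fun f => ?_
  rw [ContinuousLinearMap.adjoint_inner_left, inner_fockBasis_left]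
  split_ifs with h
  · subst h
    rw [creation_apply_cons, inner_fockBasis_left]
  · rw [creation_apply_cons_of_ne h, inner_zero_left]

theorem wordOp_nil {H : Type*} [NormedAddCommGroup H] [InnerProductSpace ℂ H]
    (T : Fin n → H →L[ℂ] H) : wordOp T [] = 1 := rfl

theorem wordOp_cons {H : Type*} [NormedAddCommGroup H] [InnerProductSpace ℂ H]
    (T : Fin n → H →L[ℂ] H) (i : Fin n) (w : List (Fin n)) :
    wordOp T (i :: w) = T i * wordOp T w := by
  simp [wordOp]

theorem wordOp_append {H : Type*} [NormedAddCommGroup H] [InnerProductSpace ℂ H]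
    (T : Fin n → H →L[ℂ] H) (v w : List (Fin n)) :
    wordOp T (v ++ w) = wordOp T v * wordOp T w := by
  simp [wordOp]

theorem wordOp_creation_fockBasis (v w : List (Fin n)) :
    wordOp creation v (fockBasis w) = fockBasis (v ++ w) := by
  induction v with
  | nil => rfl
  | cons i v ih =>
    rw [wordOp_cons, mul_apply_eq_comp, ih, creation_fockBasis, List.cons_append]

/-- A word is admissible if the entries of `A` at its pairs of consecutive letters do not vanish. -/
def Admissible (A : Matrix (Fin n) (Fin n) ℂ) (w : List (Fin n)) : Prop :=
  w.IsChain fun i j => A i j ≠ 0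

theorem exists_of_not_admissible {w : List (Fin n)} (hw : ¬ Admissible A w) :
    ∃ u i j v, A i j = 0 ∧ w = u ++ i :: j :: v := by
  induction w with
  | nil => exact absurd List.IsChain.nil hw
  | cons i w ih =>
    rcases w with _ | ⟨j, v⟩
    · exact absurd (List.IsChain.singleton i) hw
    · by_cases h : A i j = 0
      · exact ⟨[], i, j, v, h, rfl⟩
      · have : ¬ Admissible A (j :: v) := fun h' => hw (List.isChain_cons_cons.2 ⟨h, h'⟩)
        obtain ⟨u, a, b, v', hab, hv⟩ := ih this
        exact ⟨i :: u, a, b, v', hab, by rw [hv]; rfl⟩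

theorem Admissible.tail {i : Fin n} {w : List (Fin n)} (h : Admissible A (i :: w)) :
    Admissible A w :=
  List.IsChain.tail h

theorem apply_eq_zero_of_not_admissible {f : Fock n}
    (hf : f ∈ maximalARelationSubspace A (creation (n := n))) {w : List (Fin n)}
    (hw : ¬ Admissible A w) : f w = 0 := by
  obtain ⟨u, i, j, v, hij, rfl⟩ := exists_of_not_admissible hw
  rw [← inner_fockBasis_left]
  refine (Submodule.mem_orthogonal _ _).1 hf _ (Submodule.subset_span ⟨u, i, j, fockBasis v, ?_⟩)
  rw [hij, zero_smul, sub_zero, mul_apply_eq_comp, creation_fockBasis,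
    creation_fockBasis, wordOp_creation_fockBasis]

/-- If `a_ij = 1` the vector vanishes; if `a_ij = 0` it is supported on words beginning with `u i
j`, none of which is admissible. Hence `Γ_A` consists exactly of the vectors supported on admissible
words. -/
theorem relation_apply_of_admissible (hA : IsZeroOne A) (i j : Fin n) (g : Fock n)
    (u : List (Fin n)) {w : List (Fin n)} (hw : Admissible A w) :
    wordOp creation u
      ((creation i * creation j - A i j • (creation i * creation j)) g) w = 0 := by
  induction u generalizing w with
  | nil =>
    rcases hA i j with h | h
    · rw [h, zero_smul, sub_zero, wordOp_nil, one_apply_eq_self,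
        mul_apply_eq_comp]
      rcases w with _ | ⟨a, _ | ⟨b, w⟩⟩
      · exact creation_apply_nil _ _
      · by_cases hi : i = a
        · subst hi
          rw [creation_apply_cons, creation_apply_nil]
        · exact creation_apply_cons_of_ne hi _ _
      · by_cases hi : i = a
        · subst hi
          rw [creation_apply_cons]
          refine creation_apply_cons_of_ne ?_ _ _
          rintro rfl
          exact (List.isChain_cons_cons.1 hw).1 h
        · exact creation_apply_cons_of_ne hi _ _
    · rw [h, one_smul, sub_self, _root_.zero_apply, map_zero]
      rfl
  | cons k u ih =>
    rw [wordOp_cons, mul_apply_eq_comp]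
    rcases w with _ | ⟨a, w⟩
    · exact creation_apply_nil _ _
    · by_cases hk : k = a
      · subst hk
        rw [creation_apply_cons]
        exact ih hw.tail
      · exact creation_apply_cons_of_ne hk _ _

theorem fockBasis_mem (hA : IsZeroOne A) {w : List (Fin n)} (hw : Admissible A w) :
    fockBasis w ∈ maximalARelationSubspace A (creation (n := n)) := by
  rw [Submodule.mem_orthogonal']
  intro x hx
  induction hx using Submodule.span_induction with
  | mem x hx =>
    obtain ⟨u, i, j, g, rfl⟩ := hx
    rw [inner_fockBasis_left]
    exact relation_apply_of_admissible hA i j g u hw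
  | zero => exact inner_zero_right _
  | add x y _ _ hx hy => rw [inner_add_right, hx, hy, add_zero]
  | smul c x _ hx => rw [inner_smul_right, hx, mul_zero]

variable (A)

/-- The projection of the basis vector `e^w` to the `A`-Fock space. -/
def aBasis (w : List (Fin n)) : AFock A :=
  ContinuousLinearMap.adjoint (AFock.incl A).toContinuousLinearMap (fockBasis w)

theorem incl_apply_eq_zero (f : AFock A) {w : List (Fin n)} (hw : ¬ Admissible A w) :
    AFock.incl A f w = 0 :=
  apply_eq_zero_of_not_admissible (Subtype.property f) hw

theorem adjoint_incl_incl (f : AFock A) :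
    ContinuousLinearMap.adjoint (AFock.incl A).toContinuousLinearMap (AFock.incl A f) = f := by
  refine ext_inner_right ℂ fun g => ?_
  rw [ContinuousLinearMap.adjoint_inner_left]
  exact (AFock.incl A).inner_map_map f g

theorem inner_aBasis_left (w : List (Fin n)) (f : AFock A) :
    inner ℂ (aBasis A w) f = AFock.incl A f w := by
  rw [aBasis, ContinuousLinearMap.adjoint_inner_left]
  exact inner_fockBasis_left _ _

variable {A}

theorem aBasis_eq_zero {w : List (Fin n)} (hw : ¬ Admissible A w) : aBasis A w = 0 := by
  refine ext_inner_right ℂ fun f => ?_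
  rw [inner_aBasis_left, incl_apply_eq_zero A f hw, inner_zero_left]

theorem incl_aBasis (hA : IsZeroOne A) {w : List (Fin n)} (hw : Admissible A w) :
    AFock.incl A (aBasis A w) = fockBasis w := by
  obtain ⟨f, hf⟩ : ∃ f : AFock A, AFock.incl A f = fockBasis w :=
    ⟨⟨fockBasis w, fockBasis_mem hA hw⟩, rfl⟩
  rw [aBasis, ← hf, adjoint_incl_incl]

theorem inner_aBasis_aBasis (hA : IsZeroOne A) {v w : List (Fin n)} (hw : Admissible A w) :
    inner ℂ (aBasis A v) (aBasis A w) = if v = w then 1 else 0 := by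
  rw [inner_aBasis_left, incl_aBasis hA hw, fockBasis_apply]

/-- No admissibility hypothesis is needed, since the projected basis vector of a non-admissible word
is zero and such a word stays non-admissible when extended on the left. -/
theorem aCreation_aBasis (hA : IsZeroOne A) (i : Fin n) (w : List (Fin n)) :
    aCreation A i (aBasis A w) = aBasis A (i :: w) := by
  by_cases hw : Admissible A w
  · have h : (AFock.incl A).toContinuousLinearMap (aBasis A w) = fockBasis w := incl_aBasis hA hw
    rw [aCreation, ContinuousLinearMap.comp_apply, ContinuousLinearMap.comp_apply, h,
      creation_fockBasis]
    rfl
  · rw [aBasis_eq_zero hw, map_zero, aBasis_eq_zero fun h => hw h.tail]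

theorem star_aCreation_apply (i : Fin n) (f : AFock A) :
    star (aCreation A i) f = ContinuousLinearMap.adjoint (AFock.incl A).toContinuousLinearMap
      (ContinuousLinearMap.adjoint (creation i) (AFock.incl A f)) := by
  rw [ContinuousLinearMap.star_eq_adjoint, aCreation, ContinuousLinearMap.adjoint_comp,
    ContinuousLinearMap.adjoint_comp, ContinuousLinearMap.adjoint_adjoint]
  rfl

theorem admissible_nil : Admissible A [] := List.IsChain.nil

theorem star_aCreation_aBasis_nil (hA : IsZeroOne A) (i : Fin n) :
    star (aCreation A i) (aBasis A []) = 0 := by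
  rw [star_aCreation_apply, incl_aBasis hA admissible_nil, adjoint_creation_fockBasis_nil, map_zero]

theorem star_aCreation_aBasis_cons (hA : IsZeroOne A) (i j : Fin n) {w : List (Fin n)}
    (hw : Admissible A (j :: w)) :
    star (aCreation A i) (aBasis A (j :: w)) = if i = j then aBasis A w else 0 := by
  rw [star_aCreation_apply, incl_aBasis hA hw, adjoint_creation_fockBasis_cons]
  split_ifs
  · rfl
  · exact map_zero _

theorem star_aCreation_aBasis_cons_of_ne (hA : IsZeroOne A) {i j : Fin n} (h : i ≠ j)
    (w : List (Fin n)) : star (aCreation A i) (aBasis A (j :: w)) = 0 := by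
  by_cases hw : Admissible A (j :: w)
  · rw [star_aCreation_aBasis_cons hA i j hw, if_neg h]
  · rw [aBasis_eq_zero hw, map_zero]

theorem aFock_eq_zero {f : AFock A} (hf : ∀ w, inner ℂ (aBasis A w) f = 0) : f = 0 := by
  refine (AFock.incl A).injective ?_
  rw [map_zero]
  apply lp.ext
  funext w
  rw [← inner_aBasis_left, hf]
  rfl

theorem aBasis_dense :
    (Submodule.span ℂ (Set.range (aBasis A))).topologicalClosure = ⊤ := by
  rw [Submodule.topologicalClosure_eq_top_iff, eq_bot_iff]
  intro f hf
  exact aFock_eq_zero fun w => (Submodule.mem_orthogonal _ _).1 hf _ (Submodule.subset_span ⟨w, rfl⟩)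

theorem operator_ext {E : Type*} [NormedAddCommGroup E] [NormedSpace ℂ E]
    {X Y : AFock A →L[ℂ] E}
    (h : ∀ w, Admissible A w → X (aBasis A w) = Y (aBasis A w)) : X = Y := by
  refine ContinuousLinearMap.ext_on (s := Set.range (aBasis A)) ?_ ?_
  · rw [Submodule.dense_iff_topologicalClosure_eq_top, aBasis_dense]
  · rintro _ ⟨w, rfl⟩
    by_cases hw : Admissible A w
    · exact h w hw
    · rw [aBasis_eq_zero hw, map_zero, map_zero]

theorem star_aCreation_mul_of_ne (hA : IsZeroOne A) {i j : Fin n} (h : i ≠ j) :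
    star (aCreation A i) * aCreation A j = 0 := by
  refine operator_ext fun w _ => ?_
  rw [mul_apply_eq_comp, aCreation_aBasis hA,
    star_aCreation_aBasis_cons_of_ne hA h]
  rfl

/-- Both sides are diagonal in the admissible words: they fix the vacuum, and they fix or kill `e^w`
according to whether the first letter `k` of `w` has `a_ik = 1` or `a_ik = 0`. -/
theorem star_aCreation_mul_self (hA : IsZeroOne A) (i : Fin n) :
    star (aCreation A i) * aCreation A i
      = 1 - ∑ j, (1 - A i j) • (aCreation A j * star (aCreation A j)) := by
  refine operator_ext fun w hw => ?_
  simp only [mul_apply_eq_comp, _root_.sub_apply,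
    one_apply_eq_self, _root_.sum_apply, _root_.smul_apply]
  rw [aCreation_aBasis hA]
  rcases w with _ | ⟨k, w⟩
  · rw [star_aCreation_aBasis_cons hA i i (List.IsChain.singleton i), if_pos rfl,
      Finset.sum_eq_zero, sub_zero]
    intro j _
    rw [star_aCreation_aBasis_nil hA, map_zero, smul_zero]
  · rw [Finset.sum_eq_single k, star_aCreation_aBasis_cons hA k k hw, if_pos rfl,
      aCreation_aBasis hA]
    · rcases hA i k with h | h
      · have : ¬ Admissible A (i :: k :: w) := fun h' => (List.isChain_cons_cons.1 h').1 h
        rw [aBasis_eq_zero this, map_zero, h, sub_zero, one_smul, sub_self]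
      · have : Admissible A (i :: k :: w) := List.isChain_cons_cons.2 ⟨by simp [h], hw⟩
        rw [star_aCreation_aBasis_cons hA i i this, if_pos rfl, h, sub_self, zero_smul, sub_zero]
    · intro j _ hj
      rw [star_aCreation_aBasis_cons_of_ne hA hj, map_zero, smul_zero]
    · simp

theorem wordOp_eq_zero {H : Type*} [NormedAddCommGroup H] [InnerProductSpace ℂ H]
    {T : Fin n → H →L[ℂ] H} (hT : SatisfiesARelations A T) {w : List (Fin n)}
    (hw : ¬ Admissible A w) : wordOp T w = 0 := by
  obtain ⟨u, i, j, v, hij, rfl⟩ := exists_of_not_admissible hw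
  have h := hT i j
  rw [hij, zero_smul] at h
  rw [wordOp_append, wordOp_cons, wordOp_cons, ← mul_assoc (T i), h, zero_mul, mul_zero]

end FockBasis

/-! ### Wick ordering of *-polynomials -/

section Span

variable {n : ℕ} {A : Matrix (Fin n) (Fin n) ℂ} {B : Type*} [Ring B] [StarRing B] [Algebra ℂ B]

/-- The linear span of the elements `s^α (s^β)^*`. -/
def wickSpan (s : Fin n → B) : Submodule ℂ B :=
  Submodule.span ℂ {x | ∃ v w : List (Fin n), x = (v.map s).prod * star (w.map s).prod}

theorem mul_mem_wickSpan (s : Fin n → B) (i : Fin n) {x : B} (hx : x ∈ wickSpan s) :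
    s i * x ∈ wickSpan s := by
  induction hx using Submodule.span_induction with
  | mem x hx =>
    obtain ⟨v, w, rfl⟩ := hx
    exact Submodule.subset_span ⟨i :: v, w, by simp [mul_assoc]⟩
  | zero => simp
  | add x y _ _ hx hy => rw [mul_add]; exact add_mem hx hy
  | smul c x _ hx => rw [mul_smul_comm]; exact Submodule.smul_mem _ _ hx

theorem star_mul_mem_wickSpan {s : Fin n → B} (h0 : ∀ i j, i ≠ j → star (s i) * s j = 0)
    (h1 : ∀ i, star (s i) * s i = 1 - ∑ j, (1 - A i j) • (s j * star (s j))) (i : Fin n) {x : B}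
    (hx : x ∈ wickSpan s) : star (s i) * x ∈ wickSpan s := by
  induction hx using Submodule.span_induction with
  | mem x hx =>
    obtain ⟨v, w, rfl⟩ := hx
    induction v generalizing i with
    | nil => exact Submodule.subset_span ⟨[], w ++ [i], by simp⟩
    | cons j v ih =>
      rw [List.map_cons, List.prod_cons, mul_assoc, ← mul_assoc (star (s i))]
      by_cases hij : i = j
      · subst hij
        rw [h1, sub_mul, one_mul, Finset.sum_mul]
        refine sub_mem (Submodule.subset_span ⟨v, w, rfl⟩) (sum_mem fun k _ => ?_)
        rw [smul_mul_assoc, mul_assoc]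
        -- The relation replaces `s_i^* s_i` by terms `s_k s_k^*`, whose adjoint now meets the
        -- shorter word `v`; its letter `k` is arbitrary, so the induction is uniform in `i`.
        exact Submodule.smul_mem _ _ (mul_mem_wickSpan s k (ih k))
      · rw [h0 i j hij, zero_mul]
        exact zero_mem _
  | zero => simp
  | add x y _ _ hx hy => rw [mul_add]; exact add_mem hx hy
  | smul c x _ hx => rw [mul_smul_comm]; exact Submodule.smul_mem _ _ hx

variable [StarModule ℂ B]

theorem adjoin_subset_wickSpan {s : Fin n → B} (h0 : ∀ i j, i ≠ j → star (s i) * s j = 0)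
    (h1 : ∀ i, star (s i) * s i = 1 - ∑ j, (1 - A i j) • (s j * star (s j))) {x : B}
    (hx : x ∈ StarAlgebra.adjoin ℂ (Set.range s)) : x ∈ wickSpan s := by
  have hx' : x ∈ Algebra.adjoin ℂ (Set.range s ∪ star (Set.range s)) := by
    rwa [← StarAlgebra.adjoin_toSubalgebra]
  -- The span being stable under left multiplication by `x` is a property that passes to products of
  -- such `x` at once; the claim is the case `m = 1`.
  have key : ∀ m ∈ wickSpan s, x * m ∈ wickSpan s := by
    clear hx
    induction hx' using Algebra.adjoin_induction with
    | mem x hx =>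
      rcases hx with ⟨i, rfl⟩ | hx
      · exact fun m hm => mul_mem_wickSpan s i hm
      · obtain ⟨i, hi⟩ := hx
        rw [← star_star x, ← hi]
        exact fun m hm => star_mul_mem_wickSpan h0 h1 i hm
    | algebraMap r =>
      intro m hm
      rw [← Algebra.smul_def]
      exact Submodule.smul_mem _ _ hm
    | add x y _ _ hx hy =>
      intro m hm
      rw [add_mul]
      exact add_mem (hx m hm)
        (hy m hm)
    | mul x y _ _ hx hy =>
      intro m hm
      rw [mul_assoc]
      exact hx _
        (hy m hm)
  simpa using key 1 (Submodule.subset_span ⟨[], [], by simp⟩)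

end Span

/-! ### Equality of the defect ranks -/

section Rank

variable {n : ℕ} {H : Type*} [NormedAddCommGroup H] [InnerProductSpace ℂ H]
  {L : Type*} [NormedAddCommGroup L] [InnerProductSpace ℂ L] [CompleteSpace L]

theorem star_mul_eq_zero_of_ne {R : Fin n → L →L[ℂ] L} (hR : HasOrthogonalRanges R) {i j : Fin n}
    (h : i ≠ j) : star (R i) * R j = 0 := by
  ext x
  refine ext_inner_left ℂ fun y => ?_
  rw [mul_apply_eq_comp, ContinuousLinearMap.star_eq_adjoint,
    ContinuousLinearMap.adjoint_inner_right, hR i j h, _root_.zero_apply,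
    inner_zero_right]

theorem defect_mul {R : Fin n → L →L[ℂ] L} (hp : ∀ i, R i * star (R i) * R i = R i)
    (ho : HasOrthogonalRanges R) (i : Fin n) : defect R * R i = 0 := by
  rw [defect, sub_mul, one_mul, Finset.sum_mul, Finset.sum_eq_single i, hp, sub_self]
  · intro j _ hj
    rw [mul_assoc, star_mul_eq_zero_of_ne ho hj, mul_zero]
  · simp

theorem star_defect (R : Fin n → L →L[ℂ] L) : star (defect R) = defect R := by
  simp [defect, star_sum]

theorem defect_mul_self {R : Fin n → L →L[ℂ] L} (hp : ∀ i, R i * star (R i) * R i = R i)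
    (ho : HasOrthogonalRanges R) : defect R * defect R = defect R := by
  nth_rewrite 2 [defect]
  rw [mul_sub, mul_one, Finset.mul_sum, Finset.sum_eq_zero, sub_zero]
  intro i _
  rw [← mul_assoc, defect_mul hp ho, zero_mul]

/-- The defect kills `R^α V h` for every nonempty `α`, so on the dense span from minimality only the
empty word contributes. -/
theorem range_defect_le {V : H →ₗᵢ[ℂ] L} {R : Fin n → L →L[ℂ] L} (hm : IsMinimal V R)
    (hp : ∀ i, R i * star (R i) * R i = R i) (ho : HasOrthogonalRanges R) :
    LinearMap.range (defect R : L →ₗ[ℂ] L)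
      ≤ (LinearMap.range ((defect R : L →ₗ[ℂ] L) ∘ₗ V.toLinearMap)).topologicalClosure := by
  set M := LinearMap.range ((defect R : L →ₗ[ℂ] L) ∘ₗ V.toLinearMap)
  rintro _ ⟨x, rfl⟩
  have hx : x ∈ (Submodule.span ℂ {x : L | ∃ (α : List (Fin n)) (h : H),
      x = wordOp R α (V h)}).topologicalClosure := by
    rw [hm]
    trivial
  refine map_mem_closure (defect R).continuous hx fun y hy => ?_
  induction hy using Submodule.span_induction with
  | mem y hy =>
    obtain ⟨_ | ⟨i, w⟩, h, rfl⟩ := hy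
    · exact ⟨h, rfl⟩
    · have : defect R (wordOp R (i :: w) (V h)) = 0 := by
        rw [← mul_apply_eq_comp, wordOp_cons, ← mul_assoc, defect_mul hp ho, zero_mul]
        rfl
      exact this ▸ zero_mem M
  | zero => rw [map_zero]; exact zero_mem M
  | add y z _ _ hy hz => rw [map_add]; exact add_mem (S := Submodule ℂ L) hy hz
  | smul c y _ hy => rw [map_smul]; exact Submodule.smul_mem M c hy

variable [CompleteSpace H]

theorem IsDilation.inner_defect {T : Fin n → H →L[ℂ] H} {V : H →ₗᵢ[ℂ] L} {R : Fin n → L →L[ℂ] L}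
    (h : IsDilation T V R) (x y : H) :
    inner ℂ (V x) (defect R (V y)) = inner ℂ x (defect T y) := by
  simp only [defect, _root_.sub_apply, one_apply_eq_self,
    _root_.sum_apply, mul_apply_eq_comp, inner_sub_right, inner_sum,
    V.inner_map_map]
  congr 1
  refine Finset.sum_congr rfl fun i _ => ?_
  rw [← ContinuousLinearMap.adjoint_inner_left, ← ContinuousLinearMap.star_eq_adjoint, h i x, h i y,
    V.inner_map_map, ContinuousLinearMap.star_eq_adjoint, ContinuousLinearMap.adjoint_inner_left]

theorem IsDilation.inner_defect_defect {T : Fin n → H →L[ℂ] H} {V : H →ₗᵢ[ℂ] L}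
    {R : Fin n → L →L[ℂ] L} (h : IsDilation T V R) (hp : ∀ i, R i * star (R i) * R i = R i)
    (ho : HasOrthogonalRanges R) (x y : H) :
    inner ℂ (defect R (V x)) (defect R (V y)) = inner ℂ x (defect T y) := by
  rw [← h.inner_defect x y, ← ContinuousLinearMap.adjoint_inner_right,
    ← ContinuousLinearMap.star_eq_adjoint, star_defect, ← mul_apply_eq_comp,
    defect_mul_self hp ho]

/-- Two maps on `H` with equal kernels have isomorphic ranges. Density of the range of `f` in that
of `defect R` then suffices, because a finite-dimensional range is closed and infinite ranks are not
distinguished. -/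
theorem opRank_defect_eq {T : Fin n → H →L[ℂ] H} {V : H →ₗᵢ[ℂ] L} {R : Fin n → L →L[ℂ] L}
    (h : IsDilation T V R) (hm : IsMinimal V R) (hp : ∀ i, R i * star (R i) * R i = R i)
    (ho : HasOrthogonalRanges R) : opRank (defect R) = opRank (defect T) := by
  set f : H →ₗ[ℂ] L := (defect R : L →ₗ[ℂ] L) ∘ₗ V.toLinearMap with hf
  have hker : LinearMap.ker f = LinearMap.ker (defect T : H →ₗ[ℂ] H) := by
    ext x
    rw [LinearMap.mem_ker, LinearMap.mem_ker]
    constructor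
    · intro hx
      refine ext_inner_left ℂ fun y => ?_
      rw [ContinuousLinearMap.coe_coe, ← h.inner_defect_defect hp ho y x, inner_zero_right]
      have hx' : defect R (V x) = 0 := hx
      rw [hx', inner_zero_right]
    · intro hx
      have hx' : defect T x = 0 := hx
      change defect R (V x) = 0
      rw [← inner_self_eq_zero (𝕜 := ℂ), h.inner_defect_defect hp ho, hx', inner_zero_right]
  have e : LinearMap.range f ≃ₗ[ℂ] LinearMap.range (defect T : H →ₗ[ℂ] H) :=
    f.quotKerEquivRange.symm.trans
      ((Submodule.quotEquivOfEq _ _ hker).trans (defect T : H →ₗ[ℂ] H).quotKerEquivRange)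
  have h1 : Cardinal.toENat (LinearMap.rank f)
      = Cardinal.toENat (LinearMap.rank (defect T : H →ₗ[ℂ] H)) := by
    have := congrArg Cardinal.toENat e.lift_rank_eq
    simpa only [Cardinal.toENat_lift] using this
  rw [opRank, opRank, ← h1]
  by_cases hfin : FiniteDimensional ℂ (LinearMap.range f)
  · have hr : LinearMap.range (defect R : L →ₗ[ℂ] L) = LinearMap.range f := by
      refine le_antisymm ?_ (LinearMap.range_comp_le_range _ _)
      have := range_defect_le hm hp ho
      rwa [(Submodule.closed_of_finiteDimensional _).submodule_topologicalClosure_eq] at this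
    rw [LinearMap.rank, LinearMap.rank, hr]
  · have hinf : Cardinal.aleph0 ≤ LinearMap.rank f := by
      rw [← not_lt]
      exact fun hlt => hfin (Module.rank_lt_aleph0_iff.1 hlt)
    rw [Cardinal.toENat_eq_top.2 hinf,
      Cardinal.toENat_eq_top.2 (hinf.trans (LinearMap.rank_comp_le_left _ _))]

end Rank

/-! ### The norm bound for `X ⊗ 1` -/

section Amplification

variable {ι E K : Type*} [Fintype ι] [NormedAddCommGroup E] [InnerProductSpace ℂ E]
  [NormedAddCommGroup K] [InnerProductSpace ℂ K]

/-- The sum is `⟨∑ e_b ⊗ v_b, (X ⊗ 1) ∑ e_a ⊗ u_a⟩`, and `X ⊗ 1` has norm at most `‖X‖`. An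
orthonormal basis of `K` splits `E ⊗ K` into copies of `E`, which avoids the tensor product. The
family `e` need not be orthonormal: it suffices that `c ↦ ∑ c_a e_a` is a contraction. -/
theorem norm_sum_inner_mul_inner_le_of_finiteDimensional [FiniteDimensional ℂ K] {e : ι → E}
    (he : ∀ c : ι → ℂ, ‖∑ a, c a • e a‖ ^ 2 ≤ ∑ a, ‖c a‖ ^ 2) (X : E →L[ℂ] E) (u v : ι → K) :
    ‖∑ a, ∑ b, inner ℂ (e b) (X (e a)) * inner ℂ (v b) (u a)‖
      ≤ ‖X‖ * (√(∑ a, ‖u a‖ ^ 2) * √(∑ a, ‖v a‖ ^ 2)) := by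
  set β := stdOrthonormalBasis ℂ K
  set x : Fin (Module.finrank ℂ K) → (ι → K) → E := fun i w => ∑ a, inner ℂ (β i) (w a) • e a
  have hx : ∀ w : ι → K, ∑ i, ‖x i w‖ ^ 2 ≤ ∑ a, ‖w a‖ ^ 2 := by
    intro w
    calc ∑ i, ‖x i w‖ ^ 2 ≤ ∑ i, ∑ a, ‖inner ℂ (β i) (w a)‖ ^ 2 :=
          Finset.sum_le_sum fun i _ => he _
      _ = ∑ a, ‖w a‖ ^ 2 := by
          rw [Finset.sum_comm]
          exact Finset.sum_congr rfl fun a _ => β.sum_sq_norm_inner_right (w a)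
  have hsum : ∑ a, ∑ b, inner ℂ (e b) (X (e a)) * inner ℂ (v b) (u a)
      = ∑ i, inner ℂ (x i v) (X (x i u)) := by
    have hi : ∀ i, inner ℂ (x i v) (X (x i u)) = ∑ a, ∑ b, inner ℂ (e b) (X (e a))
        * (inner ℂ (v b) (β i) * inner ℂ (β i) (u a)) := by
      intro i
      simp only [x, map_sum, map_smul]
      rw [inner_sum]
      refine Finset.sum_congr rfl fun a _ => ?_
      rw [sum_inner]
      refine Finset.sum_congr rfl fun b _ => ?_
      rw [inner_smul_left, inner_smul_right, inner_conj_symm]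
      ring
    simp only [hi]
    conv_rhs => rw [Finset.sum_comm]
    refine Finset.sum_congr rfl fun a _ => ?_
    conv_rhs => rw [Finset.sum_comm]
    refine Finset.sum_congr rfl fun b _ => ?_
    rw [← Finset.mul_sum, β.sum_inner_mul_inner]
  rw [hsum]
  calc ‖∑ i, inner ℂ (x i v) (X (x i u))‖ ≤ ∑ i, ‖X‖ * (‖x i u‖ * ‖x i v‖) := by
        refine norm_sum_le_of_le _ fun i _ => (norm_inner_le_norm _ _).trans ?_
        calc ‖x i v‖ * ‖X (x i u)‖ ≤ ‖x i v‖ * (‖X‖ * ‖x i u‖) := by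
              gcongr
              exact X.le_opNorm _
          _ = ‖X‖ * (‖x i u‖ * ‖x i v‖) := by ring
    _ = ‖X‖ * ∑ i, ‖x i u‖ * ‖x i v‖ := (Finset.mul_sum _ _ _).symm
    _ ≤ ‖X‖ * (√(∑ i, ‖x i u‖ ^ 2) * √(∑ i, ‖x i v‖ ^ 2)) := by
        gcongr
        exact Real.sum_mul_le_sqrt_mul_sqrt _ _ _
    _ ≤ ‖X‖ * (√(∑ a, ‖u a‖ ^ 2) * √(∑ a, ‖v a‖ ^ 2)) := by
        gcongr
        · exact hx u
        · exact hx v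

theorem norm_sum_inner_mul_inner_le {e : ι → E}
    (he : ∀ c : ι → ℂ, ‖∑ a, c a • e a‖ ^ 2 ≤ ∑ a, ‖c a‖ ^ 2) (X : E →L[ℂ] E) (u v : ι → K) :
    ‖∑ a, ∑ b, inner ℂ (e b) (X (e a)) * inner ℂ (v b) (u a)‖
      ≤ ‖X‖ * (√(∑ a, ‖u a‖ ^ 2) * √(∑ a, ‖v a‖ ^ 2)) := by
  -- Only inner products among the finitely many `u a`, `v b` occur, so `K` may be replaced by their
  -- span.
  set W := Submodule.span ℂ (Set.range u ∪ Set.range v)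
  have : FiniteDimensional ℂ W :=
    FiniteDimensional.span_of_finite ℂ ((Set.finite_range u).union (Set.finite_range v))
  exact norm_sum_inner_mul_inner_le_of_finiteDimensional he X
    (fun a => (⟨u a, Submodule.subset_span (Or.inl ⟨a, rfl⟩)⟩ : W))
    (fun a => (⟨v a, Submodule.subset_span (Or.inr ⟨a, rfl⟩)⟩ : W))

end Amplification

/-! ### Sums over words and the telescoping identity -/

section Words

variable {n : ℕ}

/-- The words of length less than `N`. -/
def words : ℕ → Finset (List (Fin n))
  | 0 => ∅
  | N + 1 => insert [] ((Finset.univ ×ˢ words N).map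
      ⟨fun p : Fin n × List (Fin n) => p.1 :: p.2, fun p q h => by
        simpa [Prod.ext_iff] using h⟩)

theorem mem_words {N : ℕ} {w : List (Fin n)} : w ∈ words N ↔ w.length < N := by
  induction N generalizing w with
  | zero => simp [words]
  | succ N ih =>
    rcases w with _ | ⟨i, w⟩
    · simp [words]
    · rw [words, Finset.mem_insert, Finset.mem_map]
      constructor
      · rintro (h | ⟨p, hp, h⟩)
        · simp at h
        · obtain ⟨-, rfl⟩ := List.cons.inj h
          simpa [ih] using hp
      · intro h
        exact Or.inr ⟨(i, w), by simpa [ih] using h, rfl⟩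

theorem words_inter (N M : ℕ) : (words N ∩ words M : Finset (List (Fin n))) = words (min N M) := by
  ext w
  simp [mem_words]

theorem sum_words_succ {E : Type*} [AddCommMonoid E] (f : List (Fin n) → E) (N : ℕ) :
    ∑ w ∈ words (N + 1), f w = f [] + ∑ i, ∑ w ∈ words N, f (i :: w) := by
  rw [words, Finset.sum_insert (by simp), Finset.sum_map, Finset.sum_product]
  rfl

variable {H : Type*} [NormedAddCommGroup H] [InnerProductSpace ℂ H] [CompleteSpace H]

/-- The sum of the operators `T^α (T^α)^*` over the words `α` of length `k`. -/
def wordSum (T : Fin n → H →L[ℂ] H) (k : ℕ) : H →L[ℂ] H :=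
  ∑ α : Fin k → Fin n, wordOp T (List.ofFn α) * star (wordOp T (List.ofFn α))

theorem wordSum_zero (T : Fin n → H →L[ℂ] H) : wordSum T 0 = 1 := by
  simp [wordSum, wordOp_nil]

theorem wordSum_succ (T : Fin n → H →L[ℂ] H) (k : ℕ) :
    wordSum T (k + 1) = ∑ i, T i * wordSum T k * star (T i) := by
  rw [wordSum, ← (Fin.consEquiv fun _ => Fin n).sum_comp, Fintype.sum_prod_type]
  refine Finset.sum_congr rfl fun i _ => ?_
  rw [wordSum, Finset.mul_sum, Finset.sum_mul]
  refine Finset.sum_congr rfl fun α _ => ?_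
  simp [Fin.consEquiv, List.ofFn_succ, wordOp_cons, mul_assoc]

theorem wordSum_nonneg (T : Fin n → H →L[ℂ] H) (k : ℕ) : 0 ≤ wordSum T k :=
  Finset.sum_nonneg fun _ _ => mul_star_self_nonneg _

theorem wordSum_le_one {T : Fin n → H →L[ℂ] H} (hT : IsContractive T) (k : ℕ) :
    wordSum T k ≤ 1 := by
  induction k with
  | zero => rw [wordSum_zero]
  | succ k ih =>
    rw [wordSum_succ]
    refine le_trans (Finset.sum_le_sum fun i _ => ?_) hT
    simpa using star_right_conjugate_le_conjugate ih (T i)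

theorem norm_wordSum_le_one {T : Fin n → H →L[ℂ] H} (hT : IsContractive T) (k : ℕ) :
    ‖wordSum T k‖ ≤ 1 := by
  rcases subsingleton_or_nontrivial H with h | h
  · have : wordSum T k = 0 := by
      ext x
      exact Subsingleton.elim _ _
    simp [this]
  · exact (CStarAlgebra.norm_le_norm_of_nonneg_of_le (wordSum_nonneg T k)
      (wordSum_le_one hT k)).trans norm_one.le

theorem star_wordOp_cons_apply (T : Fin n → H →L[ℂ] H) (i : Fin n) (w : List (Fin n)) (h : H) :
    star (wordOp T (i :: w)) h = star (wordOp T w) (star (T i) h) := by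
  rw [wordOp_cons, star_mul, mul_apply_eq_comp]

theorem inner_mul_star_apply (X : H →L[ℂ] H) (Y : H →L[ℂ] H) (h k : H) :
    inner ℂ k ((X * Y * star X) h) = inner ℂ (star X k) (Y (star X h)) := by
  rw [ContinuousLinearMap.star_eq_adjoint, ContinuousLinearMap.adjoint_inner_left]
  rfl

theorem inner_wordSum_succ (T : Fin n → H →L[ℂ] H) (k : ℕ) (x y : H) :
    inner ℂ y (wordSum T (k + 1) x)
      = ∑ i, inner ℂ (star (T i) y) (wordSum T k (star (T i) x)) := by
  rw [wordSum_succ, _root_.sum_apply, inner_sum]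
  exact Finset.sum_congr rfl fun i _ => inner_mul_star_apply _ _ _ _

theorem inner_defect (T : Fin n → H →L[ℂ] H) (x y : H) :
    inner ℂ y (defect T x) = inner ℂ y x - ∑ i, inner ℂ (star (T i) y) (star (T i) x) := by
  rw [defect, _root_.sub_apply, inner_sub_right, _root_.sum_apply, inner_sum]
  congr 1
  refine Finset.sum_congr rfl fun i _ => ?_
  simpa using inner_mul_star_apply (T i) 1 x y

/-- A telescoping sum: splitting off the first letter, the empty word gives `⟨y, x⟩ - ∑ ⟨T_i^* y,
T_i^* x⟩`, and the words starting with `i` give the same expression at `T_i^* x`, `T_i^* y`. For `x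
= y` it bounds the truncated Poisson kernel by `‖x‖`. -/
theorem sum_words_inner {T : Fin n → H →L[ℂ] H} {D : H →L[ℂ] H} (hD : star D * D = defect T)
    (N : ℕ) (x y : H) :
    ∑ w ∈ words N, inner ℂ (D (star (wordOp T w) y)) (D (star (wordOp T w) x))
      = inner ℂ y x - inner ℂ y (wordSum T N x) := by
  induction N generalizing x y with
  | zero => simp [words, wordSum_zero]
  | succ N ih =>
    rw [sum_words_succ, inner_wordSum_succ]
    simp only [star_wordOp_cons_apply, ih, Finset.sum_sub_distrib]
    have h : inner ℂ (D (star (wordOp T []) y)) (D (star (wordOp T []) x))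
        = inner ℂ y (defect T x) := by
      rw [← ContinuousLinearMap.adjoint_inner_right, ← ContinuousLinearMap.star_eq_adjoint,
        ← mul_apply_eq_comp, hD]
      simp [wordOp_nil]
    rw [h, inner_defect]
    ring

end Words

/-! ### The Poisson kernel and its intertwining property -/

section Poisson

variable {n : ℕ} {A : Matrix (Fin n) (Fin n) ℂ}
  {H : Type*} [NormedAddCommGroup H] [InnerProductSpace ℂ H] [CompleteSpace H]

theorem orthonormal_fockBasis : Orthonormal ℂ (fockBasis (n := n)) := by
  rw [orthonormal_iff_ite]
  intro v w
  rw [inner_fockBasis_left, fockBasis_apply]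

theorem norm_sum_smul_aBasis_sq_le {ι : Type*} [Fintype ι] {f : ι → List (Fin n)}
    (hf : Function.Injective f) (c : ι → ℂ) :
    ‖∑ a, c a • aBasis A (f a)‖ ^ 2 ≤ ∑ a, ‖c a‖ ^ 2 := by
  have h1 : ∑ a, c a • aBasis A (f a)
      = ContinuousLinearMap.adjoint (AFock.incl A).toContinuousLinearMap
        (∑ a, c a • fockBasis (f a)) := by
    simp only [map_sum, map_smul, aBasis]
  have h2 : ‖∑ a, c a • fockBasis (f a)‖ ^ 2 = ∑ a, ‖c a‖ ^ 2 := by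
    have h := (orthonormal_fockBasis.comp f hf).inner_sum c c Finset.univ
    have h' := congrArg RCLike.re h
    rw [inner_self_eq_norm_sq] at h'
    refine h'.trans ?_
    rw [map_sum]
    refine Finset.sum_congr rfl fun a _ => ?_
    rw [RCLike.conj_mul]
    norm_cast
  rw [h1, ← h2]
  gcongr
  refine (ContinuousLinearMap.le_opNorm _ _).trans ?_
  rw [LinearIsometryEquiv.norm_map]
  exact mul_le_of_le_one_left (norm_nonneg _) (LinearIsometry.norm_toContinuousLinearMap_le _)

/-- The sesquilinear form `⟨(X ⊗ 1) U_N x, U_M y⟩`, where `U_N x` is the truncated Poisson kernel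
`∑_{|w| < N} e^w ⊗ D (T^w)^* x`. -/
def poissonForm (T : Fin n → H →L[ℂ] H) (D : H →L[ℂ] H) (N M : ℕ) (X : AFock A →L[ℂ] AFock A)
    (x y : H) : ℂ :=
  ∑ a ∈ words N, ∑ b ∈ words M, inner ℂ (aBasis A b) (X (aBasis A a))
    * inner ℂ (D (star (wordOp T b) y)) (D (star (wordOp T a) x))

theorem norm_poissonForm_le {T : Fin n → H →L[ℂ] H} {D : H →L[ℂ] H}
    (hD : star D * D = defect T) (N : ℕ) (X : AFock A →L[ℂ] AFock A) (x y : H) :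
    ‖poissonForm T D N N X x y‖ ≤ ‖X‖ * (‖x‖ * ‖y‖) := by
  have hx : ∀ x : H, ∑ w : words N, ‖D (star (wordOp T w.1) x)‖ ^ 2 ≤ ‖x‖ ^ 2 := by
    intro x
    have h1 := sum_words_inner hD N x x
    have h2 : 0 ≤ RCLike.re (inner ℂ x (wordSum T N x)) :=
      (ContinuousLinearMap.nonneg_iff_isPositive _).1 (wordSum_nonneg T N) |>.re_inner_nonneg_right x
    have h3 := congrArg RCLike.re h1
    rw [map_sum, map_sub] at h3
    simp only [inner_self_eq_norm_sq] at h3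
    rw [Finset.sum_coe_sort (words N) fun w => ‖D (star (wordOp T w) x)‖ ^ 2, h3]
    linarith
  have key := norm_sum_inner_mul_inner_le
    (norm_sum_smul_aBasis_sq_le (A := A) (f := fun w : words N => w.1) Subtype.val_injective) X
    (fun w => D (star (wordOp T w.1) x)) (fun w => D (star (wordOp T w.1) y))
  have h0 : poissonForm T D N N X x y = ∑ a : words N, ∑ b : words N,
      inner ℂ (aBasis A b.1) (X (aBasis A a.1))
      * inner ℂ (D (star (wordOp T b.1) y)) (D (star (wordOp T a.1) x)) := by
    rw [poissonForm, ← Finset.sum_coe_sort]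
    refine Finset.sum_congr rfl fun a _ => ?_
    rw [← Finset.sum_coe_sort]
  rw [h0]
  refine key.trans ?_
  gcongr
  · exact Real.sqrt_le_iff.2 ⟨norm_nonneg _, hx x⟩
  · exact Real.sqrt_le_iff.2 ⟨norm_nonneg _, hx y⟩

/-- This is `(S_i^* ⊗ 1) U_{N+1} = U_N T_i^*`: only words `i w` survive, and where `i w` is not
admissible the factor `T^{iw}` vanishes by the `A`-relations. The function `Φ` stands for either
slot of the form, linear or conjugate-linear; no additivity is needed. -/
theorem sum_words_succ_star_aCreation (hA : IsZeroOne A) {T : Fin n → H →L[ℂ] H}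
    (hT : SatisfiesARelations A T) {E : Type*} [AddCommMonoid E] (Φ : AFock A → H → E)
    (h1 : ∀ x, Φ 0 x = 0) (h2 : ∀ f, Φ f 0 = 0) (i : Fin n) (N : ℕ) (x : H) :
    ∑ w ∈ words (N + 1), Φ (star (aCreation A i) (aBasis A w)) (star (wordOp T w) x)
      = ∑ w ∈ words N, Φ (aBasis A w) (star (wordOp T w) (star (T i) x)) := by
  rw [sum_words_succ, star_aCreation_aBasis_nil hA, h1, zero_add, Finset.sum_eq_single i]
  · refine Finset.sum_congr rfl fun w _ => ?_
    rw [← star_wordOp_cons_apply]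
    by_cases hw : Admissible A (i :: w)
    · rw [star_aCreation_aBasis_cons hA i i hw, if_pos rfl]
    · rw [wordOp_eq_zero hT hw, star_zero, _root_.zero_apply, h2, h2]
  · intro j _ hj
    refine Finset.sum_eq_zero fun w _ => ?_
    rw [star_aCreation_aBasis_cons_of_ne hA hj.symm, h1]
  · simp

theorem poissonForm_mul_star (hA : IsZeroOne A) {T : Fin n → H →L[ℂ] H}
    (hT : SatisfiesARelations A T) (D : H →L[ℂ] H) (N M : ℕ) (X : AFock A →L[ℂ] AFock A)
    (i : Fin n) (x y : H) :
    poissonForm T D (N + 1) M (X * star (aCreation A i)) x y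
      = poissonForm T D N M X (star (T i) x) y :=
  sum_words_succ_star_aCreation hA hT (fun f z => ∑ b ∈ words M, inner ℂ (aBasis A b) (X f)
    * inner ℂ (D (star (wordOp T b) y)) (D z)) (by simp) (by simp) i N x

theorem poissonForm_mul (hA : IsZeroOne A) {T : Fin n → H →L[ℂ] H}
    (hT : SatisfiesARelations A T) (D : H →L[ℂ] H) (N M : ℕ) (X : AFock A →L[ℂ] AFock A)
    (i : Fin n) (x y : H) :
    poissonForm T D N (M + 1) (aCreation A i * X) x y
      = poissonForm T D N M X x (star (T i) y) := by
  refine Finset.sum_congr rfl fun a _ => ?_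
  rw [← sum_words_succ_star_aCreation hA hT (fun f z => inner ℂ f (X (aBasis A a))
    * inner ℂ (D z) (D (star (wordOp T a) x))) (by simp) (by simp) i M y]
  refine Finset.sum_congr rfl fun b _ => ?_
  rw [ContinuousLinearMap.star_eq_adjoint (aCreation A i), ContinuousLinearMap.adjoint_inner_left]
  rfl

theorem poissonForm_one (hA : IsZeroOne A) {T : Fin n → H →L[ℂ] H}
    (hT : SatisfiesARelations A T) {D : H →L[ℂ] H} (hD : star D * D = defect T) (N M : ℕ)
    (x y : H) : poissonForm (A := A) T D N M 1 x y
      = inner ℂ y x - inner ℂ y (wordSum T (min N M) x) := by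
  rw [← sum_words_inner hD, ← words_inter, ← Finset.sum_ite_mem]
  refine Finset.sum_congr rfl fun a _ => ?_
  rw [one_apply_eq_self]
  by_cases ha : Admissible A a
  · simp only [inner_aBasis_aBasis hA ha, ite_mul, one_mul, zero_mul]
    rw [Finset.sum_ite_eq']
  · simp [wordOp_eq_zero hT ha]

theorem poissonForm_wordOp (hA : IsZeroOne A) {T : Fin n → H →L[ℂ] H}
    (hT : SatisfiesARelations A T) (D : H →L[ℂ] H) (N M : ℕ) (v w : List (Fin n))
    (x y : H) :
    poissonForm (A := A) T D (N + w.length) (M + v.length)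
      (wordOp (aCreation A) v * star (wordOp (aCreation A) w)) x y
      = poissonForm (A := A) T D N M 1 (star (wordOp T w) x) (star (wordOp T v) y) := by
  induction v generalizing y with
  | nil =>
    simp only [wordOp_nil, one_mul, star_one, one_apply_eq_self]
    induction w generalizing x with
    | nil => simp [wordOp_nil]
    | cons i w ih =>
      rw [wordOp_cons, star_mul, List.length_cons, ← add_assoc, poissonForm_mul_star hA hT, ih,
        star_wordOp_cons_apply]
  | cons i v ih =>
    rw [wordOp_cons, List.length_cons, ← add_assoc, mul_assoc, poissonForm_mul hA hT, ih,
      star_wordOp_cons_apply]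

theorem tendsto_poissonForm_wordOp (hA : IsZeroOne A) {T : Fin n → H →L[ℂ] H}
    (hT : SatisfiesARelations A T) {D : H →L[ℂ] H} (hD : star D * D = defect T)
    (hpure : ∀ x, Tendsto (fun N => wordSum T N x) atTop (𝓝 0)) (v w : List (Fin n)) (x y : H) :
    Tendsto (fun N => poissonForm (A := A) T D N N
      (wordOp (aCreation A) v * star (wordOp (aCreation A) w)) x y) atTop
      (𝓝 (inner ℂ y ((wordOp T v * star (wordOp T w)) x))) := by
  -- Moving `S^v` and `(S^w)^*` across shortens the two truncations by `|v|` and `|w|` respectively;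
  -- this shift leaves lengths `m + |w|` and `m + |v|`.
  rw [← tendsto_add_atTop_iff_nat (v.length + w.length)]
  have h1 : ∀ m, poissonForm (A := A) T D (m + (v.length + w.length)) (m + (v.length + w.length))
      (wordOp (aCreation A) v * star (wordOp (aCreation A) w)) x y
      = inner ℂ (star (wordOp T v) y) (star (wordOp T w) x) - inner ℂ (star (wordOp T v) y)
        (wordSum T (m + min v.length w.length) (star (wordOp T w) x)) := by
    intro m
    have := poissonForm_wordOp hA hT D (m + v.length) (m + w.length) v w x y
    rw [poissonForm_one hA hT hD, add_assoc, add_assoc, add_comm w.length, min_add_add_left] at this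
    exact this
  simp only [h1]
  have h2 : inner ℂ y ((wordOp T v * star (wordOp T w)) x)
      = inner ℂ (star (wordOp T v) y) (star (wordOp T w) x) - inner ℂ (star (wordOp T v) y) 0 := by
    rw [inner_zero_right, sub_zero, ContinuousLinearMap.star_eq_adjoint (wordOp T v),
      ContinuousLinearMap.adjoint_inner_left]
    rfl
  rw [h2]
  have h3 := (tendsto_add_atTop_iff_nat (min v.length w.length)).2
    (hpure (star (wordOp T w) x))
  exact tendsto_const_nhds.sub (tendsto_const_nhds.inner h3)

/-- The span of the pairs `(S^α (S^β)^*, T^α (T^β)^*)`. -/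
def pairSpan (A : Matrix (Fin n) (Fin n) ℂ) (T : Fin n → H →L[ℂ] H) :
    Submodule ℂ ((AFock A →L[ℂ] AFock A) × (H →L[ℂ] H)) :=
  Submodule.span ℂ {p | ∃ v w : List (Fin n),
    p = (wordOp (aCreation A) v * star (wordOp (aCreation A) w), wordOp T v * star (wordOp T w))}

theorem poissonForm_add (T : Fin n → H →L[ℂ] H) (D : H →L[ℂ] H) (N M : ℕ)
    (X Y : AFock A →L[ℂ] AFock A) (x y : H) :
    poissonForm T D N M (X + Y) x y = poissonForm T D N M X x y + poissonForm T D N M Y x y := by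
  simp only [poissonForm, _root_.add_apply, inner_add_right, add_mul, Finset.sum_add_distrib]

theorem poissonForm_smul (T : Fin n → H →L[ℂ] H) (D : H →L[ℂ] H) (N M : ℕ) (c : ℂ)
    (X : AFock A →L[ℂ] AFock A) (x y : H) :
    poissonForm T D N M (c • X) x y = c * poissonForm T D N M X x y := by
  simp only [poissonForm, _root_.smul_apply, inner_smul_right, mul_assoc, Finset.mul_sum]

theorem tendsto_poissonForm (hA : IsZeroOne A) {T : Fin n → H →L[ℂ] H}
    (hT : SatisfiesARelations A T) {D : H →L[ℂ] H} (hD : star D * D = defect T)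
    (hpure : ∀ x, Tendsto (fun N => wordSum T N x) atTop (𝓝 0))
    {p : (AFock A →L[ℂ] AFock A) × (H →L[ℂ] H)} (hp : p ∈ pairSpan A T) (x y : H) :
    Tendsto (fun N => poissonForm T D N N p.1 x y) atTop (𝓝 (inner ℂ y (p.2 x))) := by
  induction hp using Submodule.span_induction with
  | mem p hp =>
    obtain ⟨v, w, rfl⟩ := hp
    exact tendsto_poissonForm_wordOp hA hT hD hpure v w x y
  | zero => simp [poissonForm]
  | add p q _ _ hp hq =>
    simp only [Prod.fst_add, Prod.snd_add, poissonForm_add, _root_.add_apply, inner_add_right]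
    exact hp.add hq
  | smul c p _ hp =>
    simp only [Prod.smul_fst, Prod.smul_snd, poissonForm_smul, _root_.smul_apply, inner_smul_right]
    exact hp.const_mul c

theorem IsContractive.exists_star_mul_self_eq_defect {T : Fin n → H →L[ℂ] H}
    (hT : IsContractive T) : ∃ D : H →L[ℂ] H, star D * D = defect T := by
  obtain ⟨D, hD⟩ := CStarAlgebra.nonneg_iff_eq_star_mul_self.1 (sub_nonneg.2 hT)
  exact ⟨D, hD.symm⟩

theorem norm_inner_snd_le_of_pure (hA : IsZeroOne A) {T : Fin n → H →L[ℂ] H}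
    (hT : SatisfiesARelations A T) (hc : IsContractive T)
    (hpure : ∀ x, Tendsto (fun N => wordSum T N x) atTop (𝓝 0))
    {p : (AFock A →L[ℂ] AFock A) × (H →L[ℂ] H)} (hp : p ∈ pairSpan A T) (x y : H) :
    ‖inner ℂ y (p.2 x)‖ ≤ ‖p.1‖ * (‖x‖ * ‖y‖) := by
  obtain ⟨D, hD⟩ := hc.exists_star_mul_self_eq_defect
  exact le_of_tendsto (tendsto_poissonForm hA hT hD hpure hp x y).norm
    (Eventually.of_forall fun N => norm_poissonForm_le hD N p.1 x y)

end Poisson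

/-! ### The von Neumann inequality by scaling -/

section VonNeumann

variable {n : ℕ} {A : Matrix (Fin n) (Fin n) ℂ}
  {H : Type*} [NormedAddCommGroup H] [InnerProductSpace ℂ H]

theorem wordOp_smul (T : Fin n → H →L[ℂ] H) (c : ℂ) (w : List (Fin n)) :
    wordOp (fun i => c • T i) w = c ^ w.length • wordOp T w := by
  induction w with
  | nil => simp [wordOp_nil]
  | cons i w ih =>
    rw [wordOp_cons, wordOp_cons, ih, smul_mul_smul_comm, List.length_cons, pow_succ']

theorem SatisfiesARelations.smul {T : Fin n → H →L[ℂ] H} (hT : SatisfiesARelations A T) (c : ℂ) :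
    SatisfiesARelations A fun i => c • T i := by
  intro i j
  rw [smul_mul_smul_comm, smul_comm (A i j), ← hT i j]

variable [CompleteSpace H]

theorem wordSum_smul (T : Fin n → H →L[ℂ] H) (r : ℝ) (k : ℕ) :
    wordSum (fun i => (r : ℂ) • T i) k = ((r : ℂ) ^ k * (r : ℂ) ^ k) • wordSum T k := by
  rw [wordSum, wordSum, Finset.smul_sum]
  refine Finset.sum_congr rfl fun α _ => ?_
  rw [wordOp_smul, star_smul, smul_mul_smul_comm, List.length_ofFn]
  simp

theorem wordSum_one (T : Fin n → H →L[ℂ] H) : wordSum T 1 = ∑ i, T i * star (T i) := by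
  simp [wordSum_succ, wordSum_zero]

theorem IsContractive.smul {T : Fin n → H →L[ℂ] H} (hT : IsContractive T) {r : ℝ} (h0 : 0 ≤ r)
    (h1 : r ≤ 1) : IsContractive fun i => (r : ℂ) • T i := by
  have h := wordSum_smul T r 1
  rw [wordSum_one, wordSum_one, pow_one] at h
  rw [IsContractive, h]
  have h2 : ((r : ℂ) * r) • ∑ i, T i * star (T i) = (r * r) • ∑ i, T i * star (T i) := by
    rw [← Complex.ofReal_mul]
    exact Complex.coe_smul _ _
  rw [h2]
  have h3 : (0 : H →L[ℂ] H) ≤ ∑ i, T i * star (T i) := by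
    rw [← wordSum_one]
    exact wordSum_nonneg T 1
  calc (r * r) • ∑ i, T i * star (T i) ≤ (1 : ℝ) • ∑ i, T i * star (T i) :=
        smul_le_smul_of_nonneg_right (by nlinarith) h3
    _ ≤ 1 := by rw [one_smul]; exact hT

theorem tendsto_wordSum_smul {T : Fin n → H →L[ℂ] H} (hT : IsContractive T) {r : ℝ} (h0 : 0 ≤ r)
    (h1 : r < 1) (x : H) :
    Tendsto (fun N => wordSum (fun i => (r : ℂ) • T i) N x) atTop (𝓝 0) := by
  have h : Tendsto (fun N : ℕ => r ^ N * r ^ N * ‖x‖) atTop (𝓝 0) := by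
    have := tendsto_pow_atTop_nhds_zero_of_lt_one h0 h1
    simpa using (this.mul this).mul_const ‖x‖
  refine squeeze_zero_norm (fun N => ?_) h
  rw [wordSum_smul, _root_.smul_apply, norm_smul]
  have h2 : ‖(r : ℂ) ^ N * (r : ℂ) ^ N‖ = r ^ N * r ^ N := by
    rw [norm_mul, norm_pow, Complex.norm_real, Real.norm_of_nonneg h0]
  rw [h2]
  gcongr
  simpa using (wordSum T N).le_of_opNorm_le (norm_wordSum_le_one hT N) x

/-- The scaling acts on an expression for `p`, not on `p.2` itself, so `q` depends on a chosen
expression. An existential statement avoids any question of well-definedness. -/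
theorem exists_tendsto_pairSpan_smul {T : Fin n → H →L[ℂ] H}
    {p : (AFock A →L[ℂ] AFock A) × (H →L[ℂ] H)} (hp : p ∈ pairSpan A T) :
    ∃ q : ℝ → (H →L[ℂ] H), Tendsto q (𝓝 1) (𝓝 p.2) ∧
      ∀ r : ℝ, (p.1, q r) ∈ pairSpan A fun i => (r : ℂ) • T i := by
  induction hp using Submodule.span_induction with
  | mem p hp =>
    obtain ⟨v, w, rfl⟩ := hp
    refine ⟨fun r => ((r : ℂ) ^ v.length * (r : ℂ) ^ w.length) • (wordOp T v * star (wordOp T w)),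
      ?_, fun r => Submodule.subset_span ⟨v, w, ?_⟩⟩
    · have h : Continuous fun r : ℝ => ((r : ℂ) ^ v.length * (r : ℂ) ^ w.length) •
          (wordOp T v * star (wordOp T w)) := by fun_prop
      simpa using h.tendsto 1
    · rw [wordOp_smul, wordOp_smul, star_smul, smul_mul_smul_comm]
      simp
  | zero => exact ⟨fun _ => 0, tendsto_const_nhds, fun r => zero_mem _⟩
  | add p p' _ _ hp hp' =>
    obtain ⟨q, hq, hq2⟩ := hp
    obtain ⟨q', hq', hq2'⟩ := hp'
    exact ⟨fun r => q r + q' r, hq.add hq', fun r => add_mem (hq2 r) (hq2' r)⟩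
  | smul c p _ hp =>
    obtain ⟨q, hq, hq2⟩ := hp
    exact ⟨fun r => c • q r, hq.const_smul c, fun r => Submodule.smul_mem _ c (hq2 r)⟩

theorem norm_snd_le_norm_fst (hA : IsZeroOne A) {T : Fin n → H →L[ℂ] H}
    (hT : SatisfiesARelations A T) (hc : IsContractive T)
    {p : (AFock A →L[ℂ] AFock A) × (H →L[ℂ] H)} (hp : p ∈ pairSpan A T) : ‖p.2‖ ≤ ‖p.1‖ := by
  obtain ⟨q, hq, hq2⟩ := exists_tendsto_pairSpan_smul hp
  refine le_of_tendsto (x := 𝓝[<] (1 : ℝ)) (hq.mono_left nhdsWithin_le_nhds).norm ?_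
  filter_upwards [Ioo_mem_nhdsLT (zero_lt_one' ℝ)] with r hr
  refine ContinuousLinearMap.opNorm_le_bound _ (norm_nonneg _) fun x => ?_
  -- Scaling by `r < 1` makes the tuple pure. Testing against the vector `q r x` itself turns the
  -- bound on the form into one on `‖q r x‖`.
  have h := norm_inner_snd_le_of_pure hA (hT.smul r) (hc.smul hr.1.le hr.2.le)
    (tendsto_wordSum_smul hc hr.1.le hr.2) (hq2 r) x (q r x)
  rcases eq_or_ne (q r x) 0 with h0 | h0
  · rw [h0, norm_zero]
    positivity
  · have h1 : 0 < ‖q r x‖ := norm_pos_iff.2 h0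
    have h2 : ‖inner ℂ (q r x) (q r x)‖ = ‖q r x‖ * ‖q r x‖ := by
      rw [inner_self_eq_norm_sq_to_K, ← pow_two]
      simp
    rw [h2, ← mul_assoc] at h
    exact le_of_mul_le_mul_right h h1

end VonNeumann

/-! ### Homomorphisms from their graphs -/

section Graph

variable {B C : Type*} [Ring B] [StarRing B] [Algebra ℂ B] [StarModule ℂ B] [Ring C] [StarRing C]
  [Algebra ℂ C] [StarModule ℂ C]

theorem exists_starAlgHom_of_graph {S : StarSubalgebra ℂ B} {G : StarSubalgebra ℂ (B × C)}
    (hex : ∀ x ∈ S, ∃ y, (x, y) ∈ G) (h0 : ∀ y, ((0 : B), y) ∈ G → y = 0) :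
    ∃ π : S →⋆ₐ[ℂ] C, ∀ (x : S) (y : C), ((x : B), y) ∈ G → π x = y := by
  have hex' : ∀ x : S, ∃ y, ((x : B), y) ∈ G := fun x => hex x x.2
  choose f hf using hex'
  have huniq : ∀ (x : S) (y : C), ((x : B), y) ∈ G → f x = y := by
    intro x y hy
    refine sub_eq_zero.1 (h0 _ ?_)
    simpa using sub_mem (hf x) hy
  exact ⟨
    { toFun := f
      map_one' := huniq _ _ (one_mem G)
      map_mul' := fun x y => huniq _ _ (mul_mem (hf x) (hf y))
      map_zero' := huniq _ _ (zero_mem G)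
      map_add' := fun x y => huniq _ _ (add_mem (hf x) (hf y))
      commutes' := fun r => huniq _ _ (StarSubalgebra.algebraMap_mem G r)
      map_star' := fun x => huniq _ _ (star_mem (hf x)) }, huniq⟩

end Graph

/-! ### Existence and uniqueness of the representation of `C^*(S)` -/

section Representation

variable {n : ℕ} {A : Matrix (Fin n) (Fin n) ℂ}
  {L : Type*} [NormedAddCommGroup L] [InnerProductSpace ℂ L] [CompleteSpace L]

/-- The closed *-algebra generated by the pairs `(S_i, R_i)`. -/
def pairAlgebra (A : Matrix (Fin n) (Fin n) ℂ) (R : Fin n → L →L[ℂ] L) :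
    StarSubalgebra ℂ ((AFock A →L[ℂ] AFock A) × (L →L[ℂ] L)) :=
  (StarAlgebra.adjoin ℂ (Set.range fun i => (aCreation A i, R i))).topologicalClosure

theorem prod_map_pair {L : Type*} [NormedAddCommGroup L] [InnerProductSpace ℂ L]
    (R : Fin n → L →L[ℂ] L) (w : List (Fin n)) :
    (w.map fun i => (aCreation A i, R i)).prod = (wordOp (aCreation A) w, wordOp R w) := by
  induction w with
  | nil => rfl
  | cons i w ih => rw [List.map_cons, List.prod_cons, ih, wordOp_cons, wordOp_cons, Prod.mk_mul_mk]

/-- Both tuples satisfy the relations used for Wick ordering, so the ordering is done once in the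
product algebra, with the same coefficients in both components. -/
theorem adjoin_pair_subset (hA : IsZeroOne A) {R : Fin n → L →L[ℂ] L}
    (ho : HasOrthogonalRanges R)
    (hR : ∀ i, star (R i) * R i = 1 - ∑ j, (1 - A i j) • (R j * star (R j)))
    {p : (AFock A →L[ℂ] AFock A) × (L →L[ℂ] L)}
    (hp : p ∈ StarAlgebra.adjoin ℂ (Set.range fun i => (aCreation A i, R i))) :
    p ∈ pairSpan A R := by
  have h := adjoin_subset_wickSpan (A := A) (fun i j hij => ?_) (fun i => ?_) hp
  · refine Submodule.span_mono ?_ h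
    rintro _ ⟨v, w, rfl⟩
    refine ⟨v, w, ?_⟩
    rw [prod_map_pair, prod_map_pair]
    rfl
  · exact Prod.ext (star_aCreation_mul_of_ne hA hij) (star_mul_eq_zero_of_ne ho hij)
  · refine Prod.ext ?_ ?_
    · simpa [Prod.fst_sum] using star_aCreation_mul_self hA i
    · simpa [Prod.snd_sum] using hR i

theorem norm_snd_le_of_mem_pairAlgebra (hA : IsZeroOne A) {R : Fin n → L →L[ℂ] L}
    (hRA : SatisfiesARelations A R) (hc : IsContractive R) (ho : HasOrthogonalRanges R)
    (hR : ∀ i, star (R i) * R i = 1 - ∑ j, (1 - A i j) • (R j * star (R j)))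
    {p : (AFock A →L[ℂ] AFock A) × (L →L[ℂ] L)} (hp : p ∈ pairAlgebra A R) : ‖p.2‖ ≤ ‖p.1‖ := by
  have hclosed : IsClosed {p : (AFock A →L[ℂ] AFock A) × (L →L[ℂ] L) | ‖p.2‖ ≤ ‖p.1‖} :=
    isClosed_le continuous_snd.norm continuous_fst.norm
  refine hclosed.closure_subset_iff.2 (fun q hq => ?_) hp
  exact norm_snd_le_norm_fst hA hRA hc (adjoin_pair_subset hA ho hR hq)

/-- In the maximum norm of the product, the hypothesis makes the first projection isometric on the
closed algebra of pairs. Its image is then closed, and it contains every `S_i`. -/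
theorem cStarS_le_map_pairAlgebra {R : Fin n → L →L[ℂ] L}
    (h : ∀ p ∈ pairAlgebra A R, ‖p.2‖ ≤ ‖p.1‖) :
    cStarS A ≤ (pairAlgebra A R).map (StarAlgHom.fst ℂ _ _) := by
  refine StarSubalgebra.topologicalClosure_minimal ?_ ?_
  · rw [StarAlgebra.adjoin_le_iff]
    rintro _ ⟨i, rfl⟩
    exact ⟨(aCreation A i, R i), StarSubalgebra.le_topologicalClosure _
      (StarAlgebra.subset_adjoin ℂ _ ⟨i, rfl⟩), rfl⟩
  · have : CompleteSpace (pairAlgebra A R) := 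
    (StarSubalgebra.isClosed_topologicalClosure _).completeSpace_coe
    set f : pairAlgebra A R → (AFock A →L[ℂ] AFock A) := fun p => p.1.1
    have hf : Isometry f := by
      refine Isometry.of_dist_eq fun p q => ?_
      have := h (p - q : pairAlgebra A R) (p - q).2
      change dist p.1.1 q.1.1 = dist p.1 q.1
      rw [Prod.dist_eq, dist_eq_norm, dist_eq_norm]
      exact (max_eq_left this).symm
    have hr : ((pairAlgebra A R).map (StarAlgHom.fst ℂ _ _) : Set (AFock A →L[ℂ] AFock A))
        = Set.range f := by
      ext x
      constructor
      · rintro ⟨p, hp, rfl⟩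
        exact ⟨⟨p, hp⟩, rfl⟩
      · rintro ⟨p, rfl⟩
        exact ⟨p.1, p.2, rfl⟩
    rw [hr]
    exact hf.isClosedEmbedding.isClosed_range

theorem exists_representation {R : Fin n → L →L[ℂ] L}
    (h : ∀ p ∈ pairAlgebra A R, ‖p.2‖ ≤ ‖p.1‖) :
    ∃ π : cStarS A →⋆ₐ[ℂ] (L →L[ℂ] L), ∀ i, π (gen A i) = R i := by
  obtain ⟨π, hπ⟩ := exists_starAlgHom_of_graph (S := cStarS A) (G := pairAlgebra A R)
    (fun X hX => by
      obtain ⟨p, hp, rfl⟩ := cStarS_le_map_pairAlgebra h hX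
      exact ⟨p.2, hp⟩)
    (fun y hy => by simpa using h _ hy)
  refine ⟨π, fun i => hπ _ _ ?_⟩
  exact StarSubalgebra.le_topologicalClosure _ (StarAlgebra.subset_adjoin ℂ _ ⟨i, rfl⟩)

theorem norm_representation_le (π : cStarS A →⋆ₐ[ℂ] (L →L[ℂ] L)) (X : cStarS A) :
    ‖π X‖ ≤ ‖X‖ := by
  have : IsClosed (cStarS A : Set (AFock A →L[ℂ] AFock A)) :=
    StarSubalgebra.isClosed_topologicalClosure _
  let _ : CStarAlgebra (cStarS A) := StarSubalgebra.cstarAlgebra (cStarS A)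
  exact NonUnitalStarAlgHom.norm_apply_le π X

theorem representation_ext {π ρ : cStarS A →⋆ₐ[ℂ] (L →L[ℂ] L)}
    (h : ∀ i, π (gen A i) = ρ (gen A i)) : π = ρ := by
  have hcont : ∀ σ : cStarS A →⋆ₐ[ℂ] (L →L[ℂ] L), Continuous σ := fun σ =>
    AddMonoidHomClass.continuous_of_bound σ 1 fun X => by
      simpa using norm_representation_le σ X
  refine StarAlgHom.ext_topologicalClosure (hcont π) (hcont ρ) ?_
  refine StarAlgHom.ext_adjoin ?_
  rintro ⟨_, _⟩ ⟨i, rfl⟩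
  exact h i

end Representation

/-! ### Compact operators and strong convergence -/

section Compact

variable {E : Type*} [NormedAddCommGroup E] [InnerProductSpace ℂ E]

theorem isCompactOperator_rankOne (x y : E) :
    IsCompactOperator (InnerProductSpace.rankOne ℂ x y) := by
  have h : IsCompactOperator (innerSL ℂ y) := 
    isCompactOperator_of_locallyCompactSpace_dom _
  exact h.clm_comp (ContinuousLinearMap.toSpanSingleton ℂ x)

theorem isCompactOperator_sum {ι : Type*} (s : Finset ι) {f : ι → E →L[ℂ] E}
    (hf : ∀ i, IsCompactOperator (f i)) : IsCompactOperator (∑ i ∈ s, f i : E →L[ℂ] E) := by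
  classical
  induction s using Finset.induction_on with
  | empty => exact isCompactOperator_zero
  | insert i s hi ih =>
    rw [Finset.sum_insert hi]
    exact (hf i).add ih

/-- Strong convergence of uniformly bounded operators is uniform on totally bounded sets, here on
the image of the unit ball under `X`. -/
theorem tendsto_norm_mul_of_isCompactOperator {Q : ℕ → E →L[ℂ] E} (hQ : ∀ k, ‖Q k‖ ≤ 1)
    (h0 : ∀ x, Tendsto (fun k => Q k x) atTop (𝓝 0)) {X : E →L[ℂ] E} (hX : IsCompactOperator X) :
    Tendsto (fun k => ‖Q k * X‖) atTop (𝓝 0) := by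
  obtain ⟨K, hK, hXK⟩ := IsCompactOperator.image_closedBall_subset_compact (f := (X : E →ₗ[ℂ] E))
    hX 1
  rw [Metric.tendsto_nhds]
  intro ε hε
  obtain ⟨t, ht, htK⟩ := Metric.totallyBounded_iff.1 hK.totallyBounded (ε / 3) (by positivity)
  have hev : ∀ᶠ k in atTop, ∀ y ∈ t, ‖Q k y‖ < ε / 3 := by
    rw [eventually_all_finite ht]
    intro y _
    have := (h0 y).norm
    rw [norm_zero] at this
    exact this.eventually_lt_const (by positivity)
  filter_upwards [hev] with k hk
  rw [dist_zero_right, norm_norm]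
  refine lt_of_le_of_lt (b := 2 * ε / 3) ?_ (by linarith)
  refine ContinuousLinearMap.opNorm_le_of_unit_norm (by positivity) fun x hx => ?_
  have hxK : X x ∈ K := hXK ⟨x, by simp [hx], rfl⟩
  obtain ⟨y, hy, hxy⟩ := Set.mem_iUnion₂.1 (htK hxK)
  have h1 : Q k (X x) = Q k (X x - y) + Q k y := by rw [← map_add, sub_add_cancel]
  rw [mul_apply_eq_comp, h1]
  have h2 : ‖Q k (X x - y)‖ ≤ ‖X x - y‖ := by
    simpa using (Q k).le_of_opNorm_le (hQ k) (X x - y)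
  rw [Metric.mem_ball, dist_eq_norm] at hxy
  have h3 := norm_add_le (Q k (X x - y)) (Q k y)
  have h4 := hk y hy
  linarith

theorem tendsto_of_tendsto_dense {Q : ℕ → E →L[ℂ] E} (hQ : ∀ k, ‖Q k‖ ≤ 1) {s : Set E}
    (hs : ∀ x ∈ s, Tendsto (fun k => Q k x) atTop (𝓝 0)) {x : E}
    (hx : x ∈ (Submodule.span ℂ s).topologicalClosure) :
    Tendsto (fun k => Q k x) atTop (𝓝 0) := by
  have hspan : ∀ x ∈ Submodule.span ℂ s, Tendsto (fun k => Q k x) atTop (𝓝 0) := by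
    intro x hx
    induction hx using Submodule.span_induction with
    | mem x hx => exact hs x hx
    | zero => simp
    | add x y _ _ hx hy => simpa using hx.add hy
    | smul c x _ hx => simpa using hx.const_smul c
  rw [Metric.tendsto_nhds]
  intro ε hε
  obtain ⟨y, hy, hxy⟩ := Metric.mem_closure_iff.1 hx (ε / 2) (by positivity)
  have h1 := (hspan y hy).norm
  rw [norm_zero] at h1
  filter_upwards [h1.eventually_lt_const (half_pos hε)] with k hk
  have h2 : Q k x = Q k (x - y) + Q k y := by rw [← map_add, sub_add_cancel]
  have h3 : ‖Q k (x - y)‖ ≤ ‖x - y‖ := by simpa using (Q k).le_of_opNorm_le (hQ k) (x - y)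
  rw [dist_eq_norm] at hxy
  rw [dist_zero_right, h2]
  have h4 := norm_add_le (Q k (x - y)) (Q k y)
  linarith

end Compact

/-! ### The word sums on the `A`-Fock space -/

section FockWordSum

variable {n : ℕ} {A : Matrix (Fin n) (Fin n) ℂ}

theorem wordSum_aCreation_aBasis (hA : IsZeroOne A) (k : ℕ) {w : List (Fin n)}
    (hw : Admissible A w) :
    wordSum (aCreation A) k (aBasis A w) = if w.length < k then 0 else aBasis A w := by
  induction k generalizing w with
  | zero => simp [wordSum_zero]
  | succ k ih =>
    rw [wordSum_succ, _root_.sum_apply]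
    simp only [mul_apply_eq_comp]
    rcases w with _ | ⟨i, w⟩
    · simp [star_aCreation_aBasis_nil hA]
    · rw [Finset.sum_eq_single i]
      · rw [star_aCreation_aBasis_cons hA i i hw, if_pos rfl, ih hw.tail]
        simp only [List.length_cons, Nat.add_lt_add_iff_right]
        split_ifs
        · exact map_zero _
        · exact aCreation_aBasis hA i w
      · intro j _ hj
        rw [star_aCreation_aBasis_cons_of_ne hA hj, map_zero, map_zero]
      · simp

/-- The word sum is the projection onto the words of length at least `k`, so its complement has
finite rank; the non-admissible words contribute zero on the right. -/
theorem one_sub_wordSum_aCreation (hA : IsZeroOne A) (k : ℕ) :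
    1 - wordSum (aCreation A) k
      = ∑ w ∈ words k, InnerProductSpace.rankOne ℂ (aBasis A w) (aBasis A w) := by
  refine operator_ext fun v hv => ?_
  rw [_root_.sub_apply, one_apply_eq_self, wordSum_aCreation_aBasis hA k hv, _root_.sum_apply]
  simp only [InnerProductSpace.rankOne_apply, inner_aBasis_aBasis hA hv, ite_smul, one_smul,
    zero_smul]
  rw [Finset.sum_ite_eq']
  simp only [mem_words]
  split_ifs <;> simp

theorem isCompactOperator_one_sub_wordSum_aCreation (hA : IsZeroOne A) (k : ℕ) :
    IsCompactOperator (1 - wordSum (aCreation A) k : AFock A →L[ℂ] AFock A) := by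
  rw [one_sub_wordSum_aCreation hA]
  exact isCompactOperator_sum (words k) fun w =>
    isCompactOperator_rankOne (aBasis A w) (aBasis A w)

theorem isContractive_aCreation (hA : IsZeroOne A) : IsContractive (aCreation A) := by
  rw [IsContractive, ← wordSum_one, ← sub_nonneg, one_sub_wordSum_aCreation hA]
  refine Finset.sum_nonneg fun w _ => ?_
  exact (ContinuousLinearMap.nonneg_iff_isPositive _).2
    (InnerProductSpace.isPositive_rankOne_self _)

theorem tendsto_wordSum_aCreation (hA : IsZeroOne A) (f : AFock A) :
    Tendsto (fun k => wordSum (aCreation A) k f) atTop (𝓝 0) := by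
  refine tendsto_of_tendsto_dense (norm_wordSum_le_one (isContractive_aCreation hA))
    (s := Set.range (aBasis A)) ?_ (by rw [aBasis_dense]; trivial)
  rintro _ ⟨w, rfl⟩
  by_cases hw : Admissible A w
  · refine tendsto_const_nhds.congr' ?_
    filter_upwards [eventually_gt_atTop w.length] with k hk
    rw [wordSum_aCreation_aBasis hA k hw, if_pos hk]
  · simp [aBasis_eq_zero hw]

end FockWordSum

/-! ### The strong limit of the word sums -/

section Limit

variable {n : ℕ} {A : Matrix (Fin n) (Fin n) ℂ}
  {L : Type*} [NormedAddCommGroup L] [InnerProductSpace ℂ L] [CompleteSpace L]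

/-- The sum of `S^α (S^α)^*` over the words `α` of length `k`, as an element of `C^*(S)`. -/
def genWordSum (A : Matrix (Fin n) (Fin n) ℂ) (k : ℕ) : cStarS A :=
  ∑ α : Fin k → Fin n, ((List.ofFn α).map (gen A)).prod * star ((List.ofFn α).map (gen A)).prod

theorem coe_genWordSum (k : ℕ) :
    (genWordSum A k : AFock A →L[ℂ] AFock A) = wordSum (aCreation A) k := by
  have h : ∀ w : List (Fin n), (((w.map (gen A)).prod : cStarS A) : AFock A →L[ℂ] AFock A)
      = wordOp (aCreation A) w := by
    intro w
    induction w with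
    | nil => rfl
    | cons i w ih =>
      rw [List.map_cons, List.prod_cons, wordOp_cons, ← ih]
      rfl
  rw [genWordSum, wordSum, AddSubmonoidClass.coe_finsetSum]
  refine Finset.sum_congr rfl fun α _ => ?_
  rw [← h]
  rfl

theorem map_genWordSum {π : cStarS A →⋆ₐ[ℂ] (L →L[ℂ] L)} {R : Fin n → L →L[ℂ] L}
    (hπ : ∀ i, π (gen A i) = R i) (k : ℕ) : π (genWordSum A k) = wordSum R k := by
  rw [genWordSum, wordSum, map_sum]
  refine Finset.sum_congr rfl fun α _ => ?_
  have h : ∀ w : List (Fin n), π (w.map (gen A)).prod = wordOp R w := by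
    intro w
    rw [map_list_prod, List.map_map, wordOp]
    congr 2
    exact funext hπ
  rw [map_mul, map_star, h]

theorem star_wordSum (R : Fin n → L →L[ℂ] L) (k : ℕ) : star (wordSum R k) = wordSum R k := by
  simp [wordSum, star_sum]

theorem one_sub_wordSum_mem_compactPart (hA : IsZeroOne A) {π : cStarS A →⋆ₐ[ℂ] (L →L[ℂ] L)}
    {R : Fin n → L →L[ℂ] L} (hπ : ∀ i, π (gen A i) = R i) (k : ℕ) (x : L) :
    x - wordSum R k x ∈ compactPart π := by
  refine Submodule.le_topologicalClosure _ (Submodule.subset_span ⟨1 - genWordSum A k, x, ?_, ?_⟩)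
  · have h : ((1 - genWordSum A k : cStarS A) : AFock A →L[ℂ] AFock A)
        = 1 - wordSum (aCreation A) k := by
      rw [← coe_genWordSum]
      rfl
    rw [h]
    exact isCompactOperator_one_sub_wordSum_aCreation hA k
  · rw [map_sub, map_one, map_genWordSum hπ]
    rfl

/-- The operator `1 - wordSum R k` is self-adjoint with range in `L_C`, hence zero on the orthogonal
complement. -/
theorem wordSum_apply_of_mem_noncompactPart (hA : IsZeroOne A)
    {π : cStarS A →⋆ₐ[ℂ] (L →L[ℂ] L)} {R : Fin n → L →L[ℂ] L} (hπ : ∀ i, π (gen A i) = R i)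
    (k : ℕ) {x : L} (hx : x ∈ noncompactPart π) : wordSum R k x = x := by
  refine ext_inner_left ℂ fun y => ?_
  have h := (Submodule.mem_orthogonal _ _).1 hx _ (one_sub_wordSum_mem_compactPart hA hπ k y)
  rw [inner_sub_left, sub_eq_zero] at h
  rw [h, ← ContinuousLinearMap.adjoint_inner_right, ← ContinuousLinearMap.star_eq_adjoint,
    star_wordSum]

/-- On a generator, `wordSum R k (π(X) y) = π(∑_{|α|=k} S^α (S^α)^* X) y`; since `π` is contractive,
the norm is at most that of the operator on `Γ_A` times `‖y‖`, and `X` is compact. -/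
theorem tendsto_wordSum_of_mem_compactPart (hA : IsZeroOne A)
    {π : cStarS A →⋆ₐ[ℂ] (L →L[ℂ] L)} {R : Fin n → L →L[ℂ] L} (hπ : ∀ i, π (gen A i) = R i)
    (hc : IsContractive R) {x : L} (hx : x ∈ compactPart π) :
    Tendsto (fun k => wordSum R k x) atTop (𝓝 0) := by
  refine tendsto_of_tendsto_dense (norm_wordSum_le_one hc) ?_ hx
  rintro _ ⟨X, y, hX, rfl⟩
  have h := tendsto_norm_mul_of_isCompactOperator
    (norm_wordSum_le_one (isContractive_aCreation hA)) (tendsto_wordSum_aCreation hA) hX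
  refine squeeze_zero_norm (fun k => ?_) (by simpa using h.mul_const ‖y‖)
  rw [← map_genWordSum hπ, ← mul_apply_eq_comp, ← map_mul]
  refine (π (genWordSum A k * X)).le_of_opNorm_le ((norm_representation_le π _).trans ?_) y
  rw [← coe_genWordSum]
  rfl

theorem tendsto_wordSum_starProjection (hA : IsZeroOne A)
    {π : cStarS A →⋆ₐ[ℂ] (L →L[ℂ] L)} {R : Fin n → L →L[ℂ] L} (hπ : ∀ i, π (gen A i) = R i)
    (hc : IsContractive R) (x : L) :
    Tendsto (fun k => wordSum R k x) atTop (𝓝 ((noncompactPart π).starProjection x)) := by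
  have : CompleteSpace (compactPart π) :=
    (Submodule.isClosed_topologicalClosure _).completeSpace_coe
  have h : x = (noncompactPart π).starProjection x + (compactPart π).starProjection x := by
    rw [add_comm]
    exact (Submodule.starProjection_add_starProjection_orthogonal (K := compactPart π) x).symm
  have h1 := tendsto_wordSum_of_mem_compactPart hA hπ hc
    (Submodule.starProjection_apply_mem (compactPart π) x)
  have h2 : ∀ k, wordSum R k x = (noncompactPart π).starProjection x
      + wordSum R k ((compactPart π).starProjection x) := by
    intro k
    conv_lhs => rw [h]
    rw [map_add, wordSum_apply_of_mem_noncompactPart hA hπ k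
      (Submodule.starProjection_apply_mem (noncompactPart π) x)]
  simp only [h2]
  simpa using h1.const_add ((noncompactPart π).starProjection x)

end Limit

/-! ### Contractivity of the dilations -/

section Contractive

variable {n : ℕ} {L : Type*} [NormedAddCommGroup L] [InnerProductSpace ℂ L] [CompleteSpace L]

theorem isContractive_of_orthogonal {R : Fin n → L →L[ℂ] L}
    (hp : ∀ i, R i * star (R i) * R i = R i) (ho : HasOrthogonalRanges R) : IsContractive R := by
  have h : 0 ≤ defect R := by
    rw [← defect_mul_self hp ho]
    nth_rewrite 1 [← star_defect R]
    exact star_mul_self_nonneg _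
  exact sub_nonneg.1 h

theorem partialIsometry_of_isometry {R : L →L[ℂ] L} (h : Isometry R) : R * star R * R = R := by
  have : star R * R = 1 := by
    rw [ContinuousLinearMap.star_eq_adjoint]
    exact (ContinuousLinearMap.isometry_iff_adjoint_comp_self R).1 h
  rw [mul_assoc, this, mul_one]

end Contractive

end CuntzKriegerDilation

end

theorem corollary13 {n : ℕ} (A : Matrix (Fin n) (Fin n) ℂ)
    (hA : CuntzKriegerDilation.IsZeroOne A)
    {H : Type*} [NormedAddCommGroup H] [InnerProductSpace ℂ H] [CompleteSpace H]
    (T : Fin n → H →L[ℂ] H)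
    (hTc : CuntzKriegerDilation.IsContractive T)
    (hTA : CuntzKriegerDilation.SatisfiesARelations A T)
    {Hi : Type*} [NormedAddCommGroup Hi] [InnerProductSpace ℂ Hi] [CompleteSpace Hi]
    (Vi : H →ₗᵢ[ℂ] Hi) (Ti : Fin n → Hi →L[ℂ] Hi)
    (hTi : CuntzKriegerDilation.IsMinimalIsometricDilation T Vi Ti)
    {Hk : Type*} [NormedAddCommGroup Hk] [InnerProductSpace ℂ Hk] [CompleteSpace Hk]
    (Vk : H →ₗᵢ[ℂ] Hk) (Tk : Fin n → Hk →L[ℂ] Hk)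
    (hTk : CuntzKriegerDilation.IsMinimalCuntzKriegerDilation A T Vk Tk) :
    (CuntzKriegerDilation.opRank (CuntzKriegerDilation.defect Ti)
        = CuntzKriegerDilation.opRank (CuntzKriegerDilation.defect Tk) ∧
      CuntzKriegerDilation.opRank (CuntzKriegerDilation.defect Tk)
        = CuntzKriegerDilation.opRank (CuntzKriegerDilation.defect T)) ∧
    (∃! π : CuntzKriegerDilation.cStarS A →⋆ₐ[ℂ] (Hk →L[ℂ] Hk),
      ∀ i, π (CuntzKriegerDilation.gen A i) = Tk i) ∧
    ∀ π : CuntzKriegerDilation.cStarS A →⋆ₐ[ℂ] (Hk →L[ℂ] Hk),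
      (∀ i, π (CuntzKriegerDilation.gen A i) = Tk i) →
      ∀ h : Hk, Filter.Tendsto
        (fun k : ℕ => ∑ α : Fin k → Fin n,
          (CuntzKriegerDilation.wordOp Tk (List.ofFn α)
            * star (CuntzKriegerDilation.wordOp Tk (List.ofFn α))) h)
        Filter.atTop
        (nhds ((CuntzKriegerDilation.noncompactPart π).starProjection h)) := by
  have hc := CuntzKriegerDilation.isContractive_of_orthogonal hTk.partialIsometry hTk.orthogonal
  have hk := CuntzKriegerDilation.opRank_defect_eq hTk.dilation hTk.minimal hTk.partialIsometry
    hTk.orthogonal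
  have hi := CuntzKriegerDilation.opRank_defect_eq hTi.dilation hTi.minimal
    (fun i => CuntzKriegerDilation.partialIsometry_of_isometry (hTi.isometry i)) hTi.orthogonal
  refine ⟨⟨hi.trans hk.symm, hk⟩, ?_, fun π hπ h => ?_⟩
  · obtain ⟨π, hπ⟩ := CuntzKriegerDilation.exists_representation
      (fun p hp => CuntzKriegerDilation.norm_snd_le_of_mem_pairAlgebra hA hTk.aRelations hc
        hTk.orthogonal hTk.cuntzKrieger hp)
    exact ⟨π, hπ, fun ρ hρ => CuntzKriegerDilation.representation_ext fun i =>
      (hρ i).trans (hπ i).symm⟩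
  · refine (CuntzKriegerDilation.tendsto_wordSum_starProjection hA hπ hc h).congr fun k => ?_
    rw [CuntzKriegerDilation.wordSum, sum_apply]
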